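/- **Conventions.** Partitions are drawn in the French convention, $\lambda^t$ is the transpose of $\lambda$, and $\ell(\cdot)$ is the number of parts. A Young tableau of skew shape $\lambda/\mu$ is a filling of the boxes of $\lambda/\mu$ with positive integers that weakly increases along rows from left to right and strictly increases up columns. Its column reading word is obtained by reading each column from top to bottom, the columns being taken from left to right. A word in the positive integers is reverse-lattice if every suffix contains, for each $i\ge 1$, at least as many $i$'s as $(i+1)$'s. $\mathrm{LRT}(\lambda,\mu,\nu)$ is the set of Young tableaux of shape $\lambda/\mu$ and content $\nu$ whose column reading word is reverse-lattice. The group $\mathfrak S_n$ acts on sequences of length $n$ by $\sigma\cdot a=(a_{\sigma^{-1}(1)},\dots,a_{\sigma^{-1}(n)})$, and $\nu^r$ is the reversal of $\nu$. **Crystal reflections.** For a Young tableau $T$ with column reading word $w$, view each letter $i+1$ of $w$ as an opening and each letter $i$ as a closing parenthesis, and match parentheses. The unmatched letters $i,i+1$ form a subword $i^p(i+1)^q$; replace it by $i^q(i+1)^p$ and leave all other letters unchanged. $s_i(T)$ is the unique Young tableau of the same shape whose column reading word is the resulting word. For a permutation $\sigma$ with reduced word $s_{i_1}\cdots s_{i_k}$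 put $\sigma(T)=s_{i_1}(\cdots s_{i_k}(T)\cdots)$; this does not depend on the reduced word. For $\sigma\in\mathfrak S_{\ell(\nu)}$ let $\mathrm{LRT}^\sigma(\lambda,\mu,\nu)=\{\sigma(T) : T\in\mathrm{LRT}(\lambda,\mu,\nu)\}$. **Frank words.** Factor a word $w$ in the positive integers as $w=w^{(1)}\cdots w^{(m)}$ into maximal strictly decreasing words. Its column form is the composition $(|w^{(1)}|,\dots,|w^{(m)}|)$, and $w$ is frank if its Schensted insertion tableau has shape $\kappa^t$, where the partition $\kappa$ is the decreasing rearrangement of the column form (the empty word is frank, with empty column form). For partitions $\mu\subseteq\lambda$, the word $w$ is $\lambda/\mu$-compatible if $\mathrm{cont}(u)+\mu^t$ is a partition for every suffix $u$ of $w$ and $\mathrm{cont}(w)+\mu^t=\lambda^t$, where $\mathrm{cont}(u)_j$ is the number of letters $j$ in $u$. For a $\lambda/\mu$-compatible word $w$, let $\lambda^{(0)}=\lambda$ and let $\lambda^{(i)}$ be obtained from $\lambda^{(i-1)}$ by removing the top box of column $j$ for every letter $j$ of $w^{(i)}$. The Young tableau $\phi(w)$ of shape $\lambda/\mu$ has entry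 $m+1-i$ in the boxes of $\lambda^{(i-1)}/\lambda^{(i)}$, for $1\le i\le m$. **Proposition.** Let $\lambda,\mu,\nu$ be partitions with $\mu\subseteq\lambda$ and $|\nu|=|\lambda/\mu|$, and let $w_0$ be the longest element of $\mathfrak S_{\ell(\nu)}$. Then for every $\sigma\in\mathfrak S_{\ell(\nu)}$, $$\mathrm{LRT}^\sigma(\lambda,\mu,\nu)=\{\phi(w) : w \text{ is a } \lambda/\mu\text{-compatible frank word with column form } (w_0\sigma w_0)\cdot\nu^r\}.$$ -/

import Mathlib

namespace FrankWords

/-!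
Partitions are Mathlib's Young diagrams: `lam.rowLen r` is the part `λ_{r+1}`, `lam.colLen c` is the
part `λ^t_{c+1}`, and `lam.colLen 0` is the length `ℓ(λ)`. Rows and columns of a diagram are indexed
from `0`; row `0` is the longest one and is drawn at the bottom (French convention), so going up a
column means increasing the row index. Letters of words and entries of tableaux are positive
integers; a letter `c + 1` of a word that records columns stands for the column with index `c`.
-/

/-- The box in row `r` and column `c` belongs to the skew shape `lam/mu`. -/
def InSkew (lam mu : YoungDiagram) (r c : ℕ) : Prop := (r, c) ∈ lam ∧ (r, c) ∉ mu

instance (lam mu : YoungDiagram) (r c : ℕ) : Decidable (InSkew lam mu r c) := by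
  unfold InSkew; infer_instance

/-- Young tableaux of skew shape `lam/mu`: fillings of the boxes of `lam/mu` with positive integers,
weakly increasing along rows from left to right and strictly increasing up columns. Outside the skew
shape the entry is set to `0`, so that equality of tableaux is equality of fillings. -/
@[ext]
structure SkewTableau (lam mu : YoungDiagram) where
  entry : ℕ → ℕ → ℕ
  zeros : ∀ r c, ¬ InSkew lam mu r c → entry r c = 0
  pos : ∀ r c, InSkew lam mu r c → 0 < entry r c
  row_weak : ∀ r c c', c < c' → InSkew lam mu r c → InSkew lam mu r c' → entry r c ≤ entry r c'
  col_strict : ∀ r r' c, r < r' → InSkew lam mu r c → InSkew lam mu r' c → entry r c < entry r' c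

/-- The boxes of `lam/mu`, column by column from left to right, each column from top to bottom. -/
def skewBoxes (lam mu : YoungDiagram) : List (ℕ × ℕ) :=
  (List.range (lam.rowLen 0)).flatMap fun c =>
    (List.range' (mu.colLen c) (lam.colLen c - mu.colLen c)).reverse.map fun r => (r, c)

/-- The column reading word. -/
def SkewTableau.crw {lam mu : YoungDiagram} (T : SkewTableau lam mu) : List ℕ :=
  (skewBoxes lam mu).map fun b => T.entry b.1 b.2

/-- A word is lattice if every prefix contains at least as many `i`'s as `i+1`'s, for all `i ≥ 1`. -/
def IsLattice (w : List ℕ) : Prop :=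
  ∀ u, u <+: w → ∀ i, 1 ≤ i → u.count (i + 1) ≤ u.count i

/-- `LRT(lam, mu, nu)`: the tableaux of shape `lam/mu` and content `nu` whose column reading word is
reverse-lattice. -/
def LRT (lam mu nu : YoungDiagram) : Set (SkewTableau lam mu) :=
  {T | (∀ i, T.crw.count (i + 1) = nu.rowLen i) ∧ IsLattice T.crw.reverse}

/-! ### Crystal reflections -/

/-- Mark (by `true`) the first `i` that is not marked yet. -/
def markFirst (i : ℕ) : List (ℕ × Bool) → List (ℕ × Bool)
  | [] => []
  | (a, b) :: w => if a = i ∧ b = false then (a, true) :: w else (a, b) :: markFirst i w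

/-- Bracketing: each `i+1` is paired with the closest unpaired `i` that follows it (if there is one),
`i+1` playing the role of an opening and `i` that of a closing parenthesis. The flag of a letter says
whether the letter is paired. -/
def pairLetters (i : ℕ) : List ℕ → List (ℕ × Bool)
  | [] => []
  | a :: w =>
    if a = i + 1 ∧ (i, false) ∈ pairLetters i w then
      (a, true) :: markFirst i (pairLetters i w)
    else (a, false) :: pairLetters i w

/-- Replace the first `k` unpaired letters among `i`, `i+1` by `i` and the other unpaired ones by
`i+1`; all other letters stay. -/
def rewriteUnpaired (i : ℕ) : ℕ → List (ℕ × Bool) → List ℕ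
  | _, [] => []
  | k, (a, b) :: w =>
    if (a = i ∨ a = i + 1) ∧ b = false then
      match k with
      | 0 => (i + 1) :: rewriteUnpaired i 0 w
      | k + 1 => i :: rewriteUnpaired i k w
    else a :: rewriteUnpaired i k w

/-- The crystal reflection on words: the unpaired letters `i`, `i+1` form a subword
`i ⋯ i (i+1) ⋯ (i+1)` with `p` letters `i` and `q` letters `i+1`; it is replaced by the word of the
same form with `q` letters `i` and `p` letters `i+1`. -/
def reflectWord (i : ℕ) (w : List ℕ) : List ℕ :=
  rewriteUnpaired i ((pairLetters i w).count (i + 1, false)) (pairLetters i w)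

open Classical in
/-- The crystal reflection operator `s_i` on tableaux: `s_i(T)` is the unique tableau of the same
shape whose column reading word is the reflected column reading word of `T`. (Such a tableau always
exists, so the second branch is never taken.) -/
noncomputable def crystalReflection {lam mu : YoungDiagram} (i : ℕ) (T : SkewTableau lam mu) :
    SkewTableau lam mu :=
  if h : ∃ T' : SkewTableau lam mu, T'.crw = reflectWord i T.crw then h.choose else T

/-- The adjacent transposition of the (`0`-based) positions `i` and `i + 1`, i.e. `s_{i+1}` in the
usual `1`-based notation. -/
def adjSwap {n : ℕ} (i : Fin (n - 1)) : Equiv.Perm (Fin n) :=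
  Equiv.swap ⟨i, by omega⟩ ⟨i + 1, by omega⟩

/-- `word` is a reduced word of `σ`: a factorization into adjacent transpositions of minimal
length. -/
def IsReducedWord {n : ℕ} (σ : Equiv.Perm (Fin n)) (word : List (Fin (n - 1))) : Prop :=
  (word.map adjSwap).prod = σ ∧
    ∀ word' : List (Fin (n - 1)), (word'.map adjSwap).prod = σ → word.length ≤ word'.length

/-- `s_{i_1} ⋯ s_{i_k} (T)`; the rightmost operator is applied first. -/
noncomputable def crystalWord {lam mu : YoungDiagram} {n : ℕ} (word : List (Fin (n - 1)))
    (T : SkewTableau lam mu) : SkewTableau lam mu :=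
  word.foldr (fun i S => crystalReflection (i + 1) S) T

/-- The set of the tableaux `s_{i_1} ⋯ s_{i_k} (T)` for `T` in `LRT(lam, mu, nu)`. For a reduced word
`s_{i_1} ⋯ s_{i_k}` of `σ`, this is `LRT^σ(lam, mu, nu)`. -/
noncomputable def reflectedLRT (lam mu nu : YoungDiagram) (word : List (Fin (nu.colLen 0 - 1))) :
    Set (SkewTableau lam mu) :=
  crystalWord word '' LRT lam mu nu

/-! ### Frank words -/

/-- Row insertion of `x` into a weakly increasing row: `x` replaces the leftmost entry larger than
`x`, which is bumped, or is appended if there is none. -/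
def rowInsert (x : ℕ) : List ℕ → List ℕ × Option ℕ
  | [] => ([x], none)
  | y :: ys =>
    if x < y then (x :: ys, some y) else (y :: (rowInsert x ys).1, (rowInsert x ys).2)

/-- Schensted insertion of `x` into a tableau, given by the list of its rows starting with the
longest one. -/
def tableauInsert : List (List ℕ) → ℕ → List (List ℕ)
  | [], x => [[x]]
  | R :: Rs, x =>
    match rowInsert x R with
    | (R', none) => R' :: Rs
    | (R', some y) => R' :: tableauInsert Rs y

/-- The insertion tableau `P(w)`, as the list of its rows. -/
def insertionTableau (w : List ℕ) : List (List ℕ) := w.foldl tableauInsert []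

/-- The factorization of a word into maximal column words (strictly decreasing words). -/
def columnFactors (w : List ℕ) : List (List ℕ) := w.splitBy fun a b => decide (b < a)

/-- The column form of a word. -/
def colForm (w : List ℕ) : List ℕ := (columnFactors w).map List.length

/-- The partition `sort(α)`, as a Young diagram. -/
def sortDiagram (α : List ℕ) : YoungDiagram :=
  YoungDiagram.ofRowLens (α.insertionSort (· ≥ ·)) (List.pairwise_insertionSort (· ≥ ·) α).sortedGE

/-- A word is frank if its insertion tableau has shape `sort(colForm w)^t`. -/
def IsFrank (w : List ℕ) : Prop :=
  (insertionTableau w).map List.length = (sortDiagram (colForm w)).transpose.rowLens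

/-- `w` (a word in the positive integers) is `lam/mu`-compatible: `cont(u) + mu^t` is a partition for
every suffix `u` of `w`, and `cont(w) + mu^t = lam^t`. -/
structure IsCompatible (lam mu : YoungDiagram) (w : List ℕ) : Prop where
  letters_pos : ∀ x ∈ w, 0 < x
  suffix_partition : ∀ u, u <:+ w → Antitone fun c => u.count (c + 1) + mu.colLen c
  total : ∀ c, w.count (c + 1) + mu.colLen c = lam.colLen c

/-- The frank, `lam/mu`-compatible words with column form `α`. -/
def LRFrank (lam mu : YoungDiagram) (α : List ℕ) : Set (List ℕ) :=
  {w | IsFrank w ∧ colForm w = α ∧ IsCompatible lam mu w}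

/-! ### The map `φ` -/

/-- The height of column `c` of the partition `λ^{(i)}`, which is obtained from `lam` by removing, for
every letter `c + 1` of the first `i` maximal column words of `w`, the top box of column `c`. -/
def stripHeight (lam : YoungDiagram) (w : List ℕ) (i c : ℕ) : ℕ :=
  lam.colLen c - ((columnFactors w).take i).flatten.count (c + 1)

/-- The entry of `φ(w)` in a box of `lam/mu`: the number of `i` in `{1, …, m}` such that the box lies
outside `λ^{(i)}`, where `m` is the number of maximal column words of `w`. As the `λ^{(i)}` decrease,
the boxes of `λ^{(i-1)}/λ^{(i)}` get the entry `m + 1 - i`, see `phiEntry_eq`. -/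
def phiEntry (lam mu : YoungDiagram) (w : List ℕ) (r c : ℕ) : ℕ :=
  if InSkew lam mu r c then
    ((Finset.Icc 1 (columnFactors w).length).filter fun i => stripHeight lam w i c ≤ r).card
  else 0

theorem stripHeight_antitone (lam : YoungDiagram) (w : List ℕ) (c : ℕ) :
    Antitone fun i => stripHeight lam w i c := by
  intro i j hij
  have h : (((columnFactors w).take i).flatten).count (c + 1) ≤
      (((columnFactors w).take j).flatten).count (c + 1) := by
    apply List.Sublist.count_le
    apply List.Sublist.flatten
    exact (List.take_prefix_take_left hij).sublist
  simp only [stripHeight]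
  omega

theorem phiEntry_eq {lam mu : YoungDiagram} {w : List ℕ} {r c i : ℕ} (h : InSkew lam mu r c)
    (hi : 1 ≤ i) (h1 : stripHeight lam w i c ≤ r)
    (h2 : r < stripHeight lam w (i - 1) c) :
    phiEntry lam mu w r c = (columnFactors w).length + 1 - i := by
  have : ((Finset.Icc 1 (columnFactors w).length).filter fun i => stripHeight lam w i c ≤ r) =
      Finset.Icc i (columnFactors w).length := by
    ext j
    simp only [Finset.mem_filter, Finset.mem_Icc]
    constructor
    · rintro ⟨⟨_, hj⟩, hj'⟩
      refine ⟨?_, hj⟩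
      by_contra hlt
      have := stripHeight_antitone lam w c (show j ≤ i - 1 by omega)
      simp only at this
      omega
    · rintro ⟨hj, hj'⟩
      have := stripHeight_antitone lam w c hj
      simp only at this
      exact ⟨⟨by omega, hj'⟩, by omega⟩
  rw [phiEntry, if_pos h, this, Nat.card_Icc]

theorem stripHeight_eq {lam mu : YoungDiagram} {w : List ℕ} (hw : IsCompatible lam mu w)
    (i c : ℕ) : stripHeight lam w i c =
      ((columnFactors w).drop i).flatten.count (c + 1) + mu.colLen c := by
  have h1 : w = ((columnFactors w).take i).flatten ++ ((columnFactors w).drop i).flatten := by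
    rw [← List.flatten_append, List.take_append_drop]
    exact (List.flatten_splitBy _ w).symm
  have h2 := hw.total c
  have h3 := congrArg (List.count (c + 1)) h1
  rw [List.count_append] at h3
  simp only [stripHeight]
  omega

theorem stripHeight_anti_col {lam mu : YoungDiagram} {w : List ℕ} (hw : IsCompatible lam mu w)
    (i : ℕ) : Antitone fun c => stripHeight lam w i c := by
  simp only [stripHeight_eq hw]
  apply hw.suffix_partition
  refine ⟨((columnFactors w).take i).flatten, ?_⟩
  rw [← List.flatten_append, List.take_append_drop]
  exact List.flatten_splitBy _ w

theorem stripHeight_length {lam mu : YoungDiagram} {w : List ℕ} (hw : IsCompatible lam mu w)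
    (c : ℕ) : stripHeight lam w (columnFactors w).length c = mu.colLen c := by
  rw [stripHeight_eq hw]; simp

theorem stripHeight_step (lam : YoungDiagram) (w : List ℕ) (i c : ℕ) :
    stripHeight lam w i c ≤ stripHeight lam w (i + 1) c + 1 := by
  have key : ((columnFactors w).take (i + 1)).flatten.count (c + 1) ≤
      ((columnFactors w).take i).flatten.count (c + 1) + 1 := by
    by_cases hi : i < (columnFactors w).length
    · rw [List.take_succ_eq_append_getElem hi, List.flatten_append, List.count_append]
      have hmem : (columnFactors w)[i] ∈ columnFactors w := List.getElem_mem hi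
      have hch := List.isChain_of_mem_splitBy hmem
      have hnd : ((columnFactors w)[i]).Nodup := by
        have hp : List.Pairwise (fun a b : ℕ => b < a) (columnFactors w)[i] := by
          have : List.IsChain (fun a b : ℕ => a > b) (columnFactors w)[i] := by
            simpa using hch
          exact List.isChain_iff_pairwise.1 this
        exact hp.imp (fun h => by omega)
      have := List.nodup_iff_count_le_one.1 hnd (c + 1)
      simp only [List.flatten_cons, List.flatten_nil, List.append_nil]
      omega
    · rw [List.take_of_length_le (by omega), List.take_of_length_le (by omega)]
      omega
  simp only [stripHeight]
  omega

/-- The tableau `φ(w)` of shape `lam/mu` attached to a `lam/mu`-compatible word `w`. -/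
def phi (lam mu : YoungDiagram) (w : List ℕ) (hw : IsCompatible lam mu w) :
    SkewTableau lam mu where
  entry := phiEntry lam mu w
  zeros r c h := if_neg h
  pos r c h := by
    rw [phiEntry, if_pos h, Finset.card_pos]
    have h1 : mu.colLen c ≤ r := by
      have := h.2; rw [YoungDiagram.mem_iff_lt_colLen] at this; omega
    have h2 : r < lam.colLen c := YoungDiagram.mem_iff_lt_colLen.1 h.1
    have h3 := stripHeight_length hw c
    refine ⟨(columnFactors w).length, ?_⟩
    simp only [Finset.mem_filter, Finset.mem_Icc, le_refl, and_true]
    refine ⟨?_, by omega⟩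
    by_contra h0
    have h0 : (columnFactors w).length = 0 := by omega
    rw [h0] at h3
    simp [stripHeight] at h3
    omega
  row_weak r c c' hc h h' := by
    rw [phiEntry, phiEntry, if_pos h, if_pos h']
    apply Finset.card_le_card
    intro i
    simp only [Finset.mem_filter]
    rintro ⟨h1, h2⟩
    exact ⟨h1, (stripHeight_anti_col hw i hc.le).trans h2⟩
  col_strict r r' c hr h h' := by
    rw [phiEntry, phiEntry, if_pos h, if_pos h']
    have h2 : r' < lam.colLen c := YoungDiagram.mem_iff_lt_colLen.1 h'.1
    have hs : ∃ i, stripHeight lam w i c ≤ r := by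
      refine ⟨(columnFactors w).length, ?_⟩
      have := h.2
      rw [YoungDiagram.mem_iff_lt_colLen] at this
      rw [stripHeight_length hw]; omega
    classical
    have hspec := Nat.find_spec hs
    have hmin := fun m => Nat.find_min hs (m := m)
    have hle : Nat.find hs ≤ (columnFactors w).length := by
      apply Nat.find_min'
      have := h.2
      rw [YoungDiagram.mem_iff_lt_colLen] at this
      rw [stripHeight_length hw]; omega
    generalize Nat.find hs = k at hspec hmin hle
    have hk0 : stripHeight lam w 0 c = lam.colLen c := by simp [stripHeight]
    have hk1 : k ≠ 0 := by rintro rfl; omega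
    have hstep := stripHeight_step lam w (k - 1) c
    rw [Nat.sub_add_cancel (by omega)] at hstep
    have hk2 : k - 1 ≠ 0 := by
      intro h0; rw [h0, hk0] at hstep; omega
    apply Finset.card_lt_card
    refine ⟨fun i => ?_, fun hsub => ?_⟩
    · simp only [Finset.mem_filter]
      rintro ⟨h1, h2⟩
      exact ⟨h1, by omega⟩
    · have hmem : k - 1 ∈ (Finset.Icc 1 (columnFactors w).length).filter
          fun i => stripHeight lam w i c ≤ r' := by
        simp only [Finset.mem_filter, Finset.mem_Icc]
        omega
      have := (Finset.mem_filter.1 (hsub hmem)).2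
      exact hmin (k - 1) (by omega) this

/-- The set of the tableaux `φ(w)`, where `w` ranges over the `lam/mu`-compatible frank words with
column form `α`. -/
def LRFrankTab (lam mu : YoungDiagram) (α : List ℕ) : Set (SkewTableau lam mu) :=
  {T | ∃ (w : List ℕ) (hw : w ∈ LRFrank lam mu α), T = phi lam mu w hw.2.2}

/-! ### The permutation action on compositions -/

/-- `σ · a = (a_{σ⁻¹(1)}, …, a_{σ⁻¹(n)})`. -/
def permAct {n : ℕ} (σ : Equiv.Perm (Fin n)) (a : Fin n → ℕ) : Fin n → ℕ := fun i => a (σ⁻¹ i)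

/-- The composition `nu^r = (ν_ℓ, …, ν_1)`, where `ℓ = ℓ(ν)`. -/
def reversedParts (nu : YoungDiagram) : Fin (nu.colLen 0) → ℕ := fun i => nu.rowLen i.rev

/-- The longest element of the symmetric group, `i ↦ n + 1 - i` in `1`-based notation. -/
def longestPerm (n : ℕ) : Equiv.Perm (Fin n) := Fin.revPerm

/-- Every permutation has a reduced word. -/
theorem exists_isReducedWord {n : ℕ} (σ : Equiv.Perm (Fin n)) :
    ∃ word : List (Fin (n - 1)), IsReducedWord σ word := by
  classical
  have hex : ∃ k, ∃ word : List (Fin (n - 1)), (word.map adjSwap).prod = σ ∧ word.length = k := by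
    cases n with
    | zero => exact ⟨0, [], Subsingleton.elim _ _, rfl⟩
    | succ n =>
      have hmem : σ ∈ Submonoid.closure (Set.range fun i : Fin n => Equiv.swap i.castSucc i.succ) := by
        rw [Equiv.Perm.mclosure_swap_castSucc_succ]; trivial
      obtain ⟨l, hl, hprod⟩ := Submonoid.exists_list_of_mem_closure hmem
      have : ∃ word : List (Fin n), word.map (fun i => Equiv.swap i.castSucc i.succ) = l := by
        have : l ∈ Set.range (List.map fun i : Fin n => Equiv.swap i.castSucc i.succ) := by
          rw [Set.range_list_map]; exact hl
        exact this
      obtain ⟨word, rfl⟩ := this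
      exact ⟨word.length, word, hprod, rfl⟩
  obtain ⟨word, hw, hlen⟩ := Nat.find_spec hex
  refine ⟨word, hw, fun word' hw' => ?_⟩
  rw [hlen]
  exact Nat.find_min' hex ⟨word', hw', rfl⟩

end FrankWords

namespace FrankWords

/-! A tableau `T` of shape `lam/mu` with entries at most `n` is encoded by the word `colWords
T.biword n`: for each entry `n, …, 1`, the decreasing list of the columns containing that entry. Its
block lengths are the reversed content of `T`. The two operations of the theorem become transparent
on this dual word. When its maximal decreasing factors are these blocks, `phi` sends it back to `T`
(`eq_phi`, `phi_colWords`). A crystal reflection on the entries slides columns between two adjacent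
blocks, which is a Knuth equivalence (`knuth_slide`, `knuth_change`, `biword_fill`). So reflections
fix the insertion tableau and permute the block lengths.

Call `T` extremal of content `β` if the insertion tableau of its dual word has as shape the
conjugate of sorted `β` (`IsExtremal`). Three facts give the theorem. Reflections carry extremal
tableaux of content `β` to extremal tableaux of permuted content, and are involutions there. For
content `ν`, extremal means Littlewood–Richardson (`isExtremal_iff_mem_LRT`). For positive `β`,
extremal tableaux are exactly the images under `phi` of compatible frank words of column form
reversed `β`.

The second fact rests on two computations. If the entries are ballot, each block is dominated by the
next and the insertion shape is the conjugate of the block lengths (`insertionTableau_cols`).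
Conversely, turning all unpaired `i + 1` into `i` keeps the Knuth class and raises the sum of
squares of the content by `2pq`, for `p` unpaired `i` and `q` unpaired `i + 1`. Repeating this ends
at a ballot filling, whose sum of squares is determined by the insertion shape. Hence in the
extremal case `pq = 0` for every `i` (`BiSorted.unpaired_of_shape`). This also rules out a descent
between consecutive blocks, so the blocks are the maximal factors.

That the reflected filling is again a tableau follows from the Knuth invariance of compatibility:
the reflected dual word is compatible, and `phi` of it is the required tableau. -/

/-! ### Knuth invariance of Schensted insertion. -/

/-- Knuth (plactic) equivalence of words. -/
inductive Knuth : List ℕ → List ℕ → Prop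
  | refl (w : List ℕ) : Knuth w w
  | symm {v w : List ℕ} : Knuth v w → Knuth w v
  | trans {u v w : List ℕ} : Knuth u v → Knuth v w → Knuth u w
  | append {v v' w w' : List ℕ} : Knuth v v' → Knuth w w' → Knuth (v ++ w) (v' ++ w')
  | yxz {x y z : ℕ} : x < y → y ≤ z → Knuth [y, x, z] [y, z, x]
  | xzy {x y z : ℕ} : x ≤ y → y < z → Knuth [x, z, y] [z, x, y]

theorem Knuth.perm {v w : List ℕ} (h : Knuth v w) : v.Perm w := by
  induction h with
  | refl w => exact .refl _
  | symm _ ih => exact ih.symm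
  | trans _ _ ih1 ih2 => exact ih1.trans ih2
  | append _ _ ih1 ih2 => exact ih1.append ih2
  | yxz _ _ => exact .cons _ (.swap _ _ _)
  | xzy _ _ => exact .swap _ _ _

/-- Row insertion of a word: the resulting row and the word of the bumped letters. -/
def rowInsertWord : List ℕ → List ℕ → List ℕ × List ℕ
  | R, [] => (R, [])
  | R, x :: w =>
    ((rowInsertWord (rowInsert x R).1 w).1,
      (rowInsert x R).2.toList ++ (rowInsertWord (rowInsert x R).1 w).2)

theorem rowInsertWord_append (R v w : List ℕ) :
    rowInsertWord R (v ++ w) = ((rowInsertWord (rowInsertWord R v).1 w).1,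
      (rowInsertWord R v).2 ++ (rowInsertWord (rowInsertWord R v).1 w).2) := by
  induction v generalizing R with
  | nil => simp [rowInsertWord]
  | cons x v ih => simp [rowInsertWord, ih]

theorem foldl_tableauInsert_cons (w R : List ℕ) (Rs : List (List ℕ)) :
    w.foldl tableauInsert (R :: Rs) =
      (rowInsertWord R w).1 :: (rowInsertWord R w).2.foldl tableauInsert Rs := by
  induction w generalizing R Rs with
  | nil => rfl
  | cons x w ih =>
    rw [List.foldl_cons, tableauInsert]
    rcases h : rowInsert x R with ⟨R', _ | y⟩ <;> simp [rowInsertWord, ih, h]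

theorem insertionTableau_eq_cons {w : List ℕ} (hw : w ≠ []) :
    insertionTableau w =
      (rowInsertWord [] w).1 :: insertionTableau (rowInsertWord [] w).2 := by
  cases w with
  | nil => exact absurd rfl hw
  | cons x w =>
    have : insertionTableau (x :: w) = (x :: w).foldl tableauInsert [[]] := by
      simp [insertionTableau, tableauInsert, rowInsert]
    rw [this, foldl_tableauInsert_cons]
    rfl

theorem mem_of_mem_rowInsert {x y : ℕ} {R : List ℕ} (h : y ∈ (rowInsert x R).1) :
    y = x ∨ y ∈ R := by
  induction R with
  | nil => simpa [rowInsert] using h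
  | cons a R ih =>
    rw [rowInsert] at h
    split_ifs at h <;> simp at h ⊢ <;> tauto

theorem self_mem_rowInsert (x : ℕ) (R : List ℕ) : x ∈ (rowInsert x R).1 := by
  induction R with
  | nil => simp [rowInsert]
  | cons a R ih =>
    rw [rowInsert]
    split_ifs <;> simp [ih]

theorem rowInsert_sorted (x : ℕ) {R : List ℕ} (h : R.Pairwise (· ≤ ·)) :
    (rowInsert x R).1.Pairwise (· ≤ ·) := by
  induction R with
  | nil => simp [rowInsert]
  | cons a R ih =>
    rw [List.pairwise_cons] at h
    rw [rowInsert]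
    split_ifs with hx
    · exact List.pairwise_cons.2 ⟨fun b hb => hx.le.trans (h.1 b hb), h.2⟩
    · refine List.pairwise_cons.2 ⟨fun b hb => ?_, ih h.2⟩
      rcases mem_of_mem_rowInsert hb with rfl | hb
      · omega
      · exact h.1 b hb

theorem rowInsertWord_sorted (w : List ℕ) {R : List ℕ} (h : R.Pairwise (· ≤ ·)) :
    (rowInsertWord R w).1.Pairwise (· ≤ ·) := by
  induction w generalizing R with
  | nil => exact h
  | cons x w ih => exact ih (rowInsert_sorted x h)

theorem bumped_lt {x y : ℕ} {R : List ℕ} (h : (rowInsert x R).2 = some y) : x < y ∧ y ∈ R := by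
  induction R with
  | nil => simp [rowInsert] at h
  | cons a R ih =>
    rw [rowInsert] at h
    split_ifs at h <;> simp at h
    · subst h; simp; omega
    · exact ⟨(ih h).1, by simp [(ih h).2]⟩

theorem bumped_le_bumped {y z Z : ℕ} {R : List ℕ} (hR : R.Pairwise (· ≤ ·)) (hyz : y ≤ z)
    (h : (rowInsert z (rowInsert y R).1).2 = some Z) :
    ∃ Y, (rowInsert y R).2 = some Y ∧ Y ≤ Z := by
  induction R with
  | nil => simp [rowInsert, hyz.not_gt] at h
  | cons a R ih =>
    rw [List.pairwise_cons] at hR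
    by_cases hy : y < a
    · simp [rowInsert, hy, hyz.not_gt] at h ⊢
      exact hR.1 _ (bumped_lt h).2
    · have hz : ¬ z < a := by omega
      simp [rowInsert, hy, hz] at h ⊢
      exact ih hR.2 h

theorem exists_bumped_le {x y : ℕ} {R : List ℕ} (hR : R.Pairwise (· ≤ ·)) (hy : y ∈ R)
    (hxy : x < y) : ∃ z, (rowInsert x R).2 = some z ∧ z ≤ y := by
  induction R with
  | nil => simp at hy
  | cons a R ih =>
    rw [List.pairwise_cons] at hR
    by_cases hx : x < a
    · simp only [rowInsert, hx, if_true, Option.some.injEq, exists_eq_left']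
      rcases List.mem_cons.1 hy with rfl | hy
      · exact le_rfl
      · exact hR.1 _ hy
    · simp only [rowInsert, hx, if_false]
      refine ih hR.2 ?_
      rcases List.mem_cons.1 hy with rfl | hy
      · omega
      · exact hy

/-- Induction along the row up to the first letter `a` exceeding `x`. If `y < a`, the bumped words
are `a y Z` and `a Z y`; otherwise they are `Y a Z` and `Y Z a` with `a < Y ≤ Z`. Both pairs differ
by a move of the same type, or coincide when `z` bumps nothing. -/
theorem rowInsertWord_yxz {x y z : ℕ} (hxy : x < y) (hyz : y ≤ z) {R : List ℕ}
    (hR : R.Pairwise (· ≤ ·)) :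
    (rowInsertWord R [y, x, z]).1 = (rowInsertWord R [y, z, x]).1 ∧
      Knuth (rowInsertWord R [y, x, z]).2 (rowInsertWord R [y, z, x]).2 := by
  have hxz : x < z := by omega
  induction R with
  | nil =>
    simp [rowInsertWord, rowInsert, hxy, hxz.not_gt, hyz.not_gt, Knuth.refl]
  | cons a R ih =>
    rw [List.pairwise_cons] at hR
    by_cases hx : x < a
    · by_cases hy : y < a
      · simp [rowInsertWord, rowInsert, hxy, hxz.not_gt, hyz.not_gt, hy]
        rcases hZ : (rowInsert z R).2 with _ | Z
        · exact .refl _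
        · have := hR.1 _ (bumped_lt hZ).2
          exact .yxz hy this
      · have hz : ¬ z < a := by omega
        simp [rowInsertWord, rowInsert, hx, hxz.not_gt, hy, hz]
        rcases hZ : (rowInsert z (rowInsert y R).1).2 with _ | Z
        · simp; exact .refl _
        · obtain ⟨Y, hY, hYZ⟩ := bumped_le_bumped hR.2 hyz hZ
          simp [hY]
          have := (bumped_lt hY)
          exact .yxz (by omega) hYZ
    · have hy : ¬ y < a := by omega
      have hz : ¬ z < a := by omega
      simp [rowInsertWord, rowInsert, hx, hy, hz] at ih ⊢
      exact ih hR.2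

/-- At the first letter `a` exceeding `x` there are two cases. If `z < a`, the bumped words are `a c
z` and `a z c` with `c` the next letter of the row, so the move changes type. If `a ≤ z`, they are
`a Z Y` and `Z a Y` with `a ≤ Y ≤ z < Z`. -/
theorem rowInsertWord_xzy {x y z : ℕ} (hxy : x ≤ y) (hyz : y < z) {R : List ℕ}
    (hR : R.Pairwise (· ≤ ·)) :
    (rowInsertWord R [x, z, y]).1 = (rowInsertWord R [z, x, y]).1 ∧
      Knuth (rowInsertWord R [x, z, y]).2 (rowInsertWord R [z, x, y]).2 := by
  have hxz : x < z := by omega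
  induction R with
  | nil =>
    simp [rowInsertWord, rowInsert, hxy.not_gt, hxz, hxz.not_gt, hyz, Knuth.refl]
  | cons a R ih =>
    rw [List.pairwise_cons] at hR
    by_cases hx : x < a
    · by_cases hz : z < a
      · simp [rowInsertWord, rowInsert, hx, hz, hxy.not_gt, hxz, hxz.not_gt]
        cases R with
        | nil => simp [rowInsert, hyz, Knuth.refl]
        | cons c R =>
          have hc := hR.1 c (by simp)
          have : z < c := by omega
          have : y < c := by omega
          simp [rowInsert, *]
          exact .symm (.yxz hz hc)
      · simp [rowInsertWord, rowInsert, hx, hz, hxy.not_gt, hxz.not_gt]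
        obtain ⟨Y, hY, hYz⟩ := exists_bumped_le (rowInsert_sorted z hR.2)
          (self_mem_rowInsert z R) hyz
        have haY : a ≤ Y := by
          rcases mem_of_mem_rowInsert (bumped_lt hY).2 with rfl | h
          · omega
          · exact hR.1 _ h
        rcases hZ : (rowInsert z R).2 with _ | Z
        · simp; exact .refl _
        · simp [hY]
          have := (bumped_lt hZ)
          exact .xzy haY (by omega)
    · have hy : ¬ y < a := by omega
      have hz : ¬ z < a := by omega
      simp [rowInsertWord, rowInsert, hx, hy, hz] at ih ⊢
      exact ih hR.2

theorem Knuth.rowInsertWord {v w : List ℕ} (h : Knuth v w) {R : List ℕ}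
    (hR : R.Pairwise (· ≤ ·)) :
    (rowInsertWord R v).1 = (rowInsertWord R w).1 ∧
      Knuth (rowInsertWord R v).2 (rowInsertWord R w).2 := by
  induction h generalizing R with
  | refl w => exact ⟨rfl, .refl _⟩
  | symm _ ih => exact ⟨(ih hR).1.symm, (ih hR).2.symm⟩
  | trans _ _ ih1 ih2 => exact ⟨(ih1 hR).1.trans (ih2 hR).1, (ih1 hR).2.trans (ih2 hR).2⟩
  | @append v v' w w' _ _ ih1 ih2 =>
    simp only [rowInsertWord_append, ← (ih1 hR).1]
    have := ih2 (rowInsertWord_sorted v hR)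
    exact ⟨this.1, (ih1 hR).2.append this.2⟩
  | yxz h1 h2 => exact rowInsertWord_yxz h1 h2 hR
  | xzy h1 h2 => exact rowInsertWord_xzy h1 h2 hR

theorem length_bumped_le (R w : List ℕ) : (rowInsertWord R w).2.length ≤ w.length := by
  induction w generalizing R with
  | nil => simp [rowInsertWord]
  | cons x w ih =>
    have := ih (rowInsert x R).1
    rcases h : (rowInsert x R).2 with _ | y <;> simp [rowInsertWord, h] <;> omega

theorem length_bumped_nil_lt {w : List ℕ} (hw : w ≠ []) :
    (rowInsertWord [] w).2.length < w.length := by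
  cases w with
  | nil => exact absurd rfl hw
  | cons x w =>
    have := length_bumped_le [x] w
    simp [rowInsertWord, rowInsert]; omega

/-- The first rows agree, and the rest of each tableau is the insertion tableau of the bumped word.
The two bumped words are shorter and still equivalent, so induction on length applies. -/
theorem Knuth.insertionTableau_eq {v w : List ℕ} (h : Knuth v w) :
    insertionTableau v = insertionTableau w := by
  induction hn : v.length using Nat.strong_induction_on generalizing v w with
  | _ n ih =>
    by_cases hv : v = []
    · have := h.perm.length_eq
      rw [hv] at this
      rw [hv, List.length_eq_zero_iff.1 this.symm]
    · have hw : w ≠ [] := by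
        rintro rfl
        exact hv (List.length_eq_zero_iff.1 h.perm.length_eq)
      have := h.rowInsertWord (R := []) (by simp)
      rw [insertionTableau_eq_cons hv, insertionTableau_eq_cons hw, this.1]
      congr 1
      exact ih _ (hn ▸ length_bumped_nil_lt hv) this.2 rfl


/-! ### Row insertion of a chain of dominating columns. -/

/-- `DomLE A B`: `A` is at most as long as `B`, and its entries are at most those of `B`. -/
inductive DomLE : List ℕ → List ℕ → Prop
  | nil (B : List ℕ) : DomLE [] B
  | cons {a b : ℕ} {A B : List ℕ} : a ≤ b → DomLE A B → DomLE (a :: A) (b :: B)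

/-- Every letter of `R` beyond a letter of `D` is at least the corresponding letter of `U`. -/
inductive Clears (R : List ℕ) : List ℕ → List ℕ → Prop
  | nil (D : List ℕ) : Clears R D []
  | cons {d u : ℕ} {D U : List ℕ} : (∀ r ∈ R, d < r → u ≤ r) → Clears R D U →
      Clears R (d :: D) (u :: U)

theorem Clears.mono {R R' D U : List ℕ} (h : Clears R D U)
    (hR : ∀ r ∈ R', r ∈ R ∨ ∀ u ∈ U, u ≤ r) : Clears R' D U := by
  induction h with
  | nil => exact .nil _
  | cons h1 _ ih =>
    refine .cons (fun r hr hdr => ?_) (ih fun r hr => (hR r hr).imp_right fun h u hu => h u (by simp [hu]))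
    rcases hR r hr with h | h
    · exact h1 r h hdr
    · exact h _ (by simp)

theorem Clears.dom {R D D' U : List ℕ} (h : Clears R D U) (hD : DomLE D D') : Clears R D' U := by
  induction h generalizing D' with
  | nil => exact .nil _
  | cons h1 _ ih =>
    cases hD with
    | cons hab hD => exact .cons (fun r hr hdr => h1 r hr (by omega)) (ih hD)

theorem mem_rowInsert_of_lt {x r : ℕ} {R : List ℕ} (h : r ∈ (rowInsert x R).1) (hx : x < r) :
    r ∈ R := by
  rcases mem_of_mem_rowInsert h with rfl | h
  · omega
  · exact h

theorem le_of_mem_rowInsert {x r u : ℕ} {R : List ℕ} (hR : R.Pairwise (· ≤ ·))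
    (hu : (rowInsert x R).2 = some u) (hr : r ∈ R) (hx : x < r) : u ≤ r := by
  obtain ⟨z, hz, hzr⟩ := exists_bumped_le hR hr hx
  rw [hu] at hz
  cases hz
  exact hzr

/-- Insertion of a column into a row with a larger letter: everything is bumped. -/
theorem rowInsertWord_col {d : ℕ} {D R : List ℕ} (hD : (d :: D).Pairwise (· > ·))
    (hR : R.Pairwise (· ≤ ·)) (hd : d ∈ R) :
    (rowInsertWord R D).1.length = R.length ∧ (rowInsertWord R D).2.length = D.length ∧
      (rowInsertWord R D).2.Pairwise (· > ·) ∧ (∀ u ∈ (rowInsertWord R D).2, u ≤ d) ∧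
      (∀ r ∈ (rowInsertWord R D).1, r ∈ R ∨ r ∈ D) ∧
      Clears (rowInsertWord R D).1 D (rowInsertWord R D).2 := by
  induction D generalizing d R with
  | nil => simp [rowInsertWord]; exact .nil _
  | cons x D ih =>
    have hxd : x < d := (List.pairwise_cons.1 hD).1 x (by simp)
    have hD' := (List.pairwise_cons.1 hD).2
    obtain ⟨u, hu, hud⟩ := exists_bumped_le hR hd hxd
    obtain ⟨h1, h2, h3, h4, h5, h6⟩ := ih hD' (rowInsert_sorted x hR) (self_mem_rowInsert x R)
    have hxu := (bumped_lt hu).1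
    have hlen : (rowInsert x R).1.length = R.length := by
      clear h1 h2 h3 h4 h5 h6 hd ih
      induction R with
      | nil => simp [rowInsert] at hu
      | cons a R ih =>
        rw [rowInsert] at hu ⊢
        split_ifs at hu ⊢ with h
        · simp
        · simpa using ih (List.pairwise_cons.1 hR).2 (by simpa using hu)
    simp only [rowInsertWord, hu, Option.toList_some, List.cons_append, List.nil_append,
      List.length_cons, h1, h2, hlen, true_and]
    refine ⟨List.pairwise_cons.2 ⟨fun v hv => ?_, h3⟩, ?_, ?_, .cons ?_ h6⟩
    · have := h4 v hv; omega
    · intro v hv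
      rcases List.mem_cons.1 hv with rfl | hv
      · exact hud
      · have := h4 v hv; omega
    · intro r hr
      rcases h5 r hr with h | h
      · rcases mem_of_mem_rowInsert h with rfl | h <;> simp [*]
      · simp [h]
    · intro r hr hxr
      rcases h5 r hr with h | h
      · exact le_of_mem_rowInsert hR hu (mem_rowInsert_of_lt h hxr) hxr
      · have := (List.pairwise_cons.1 hD').1 r h; omega

/-- Each letter of `D` bumps some larger letter of the current row, and `Clears` bounds that letter
below by the matching letter of `U`. The letters of `D` themselves enter the row meanwhile; `hUd`
keeps them harmless for the later letters of `U`. -/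
theorem domLE_bumped {d : ℕ} {D R U : List ℕ} (hD : (d :: D).Pairwise (· > ·))
    (hR : R.Pairwise (· ≤ ·)) (hd : d ∈ R) (hU : Clears R D U) (hUp : U.Pairwise (· > ·))
    (hUd : DomLE U.tail D) : DomLE U (rowInsertWord R D).2 := by
  induction D generalizing d R U with
  | nil => cases hU; exact .nil _
  | cons x D ih =>
    have hxd : x < d := (List.pairwise_cons.1 hD).1 x (by simp)
    obtain ⟨u, hu, hud⟩ := exists_bumped_le hR hd hxd
    cases hU with
    | nil => exact .nil _
    | @cons _ v _ U h1 h2 =>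
      simp only [rowInsertWord, hu, Option.toList_some, List.cons_append, List.nil_append]
      have hxu := bumped_lt hu
      refine .cons (h1 u hxu.2 hxu.1) (ih (List.pairwise_cons.1 hD).2 (rowInsert_sorted x hR)
        (self_mem_rowInsert x R) ?_ (List.pairwise_cons.1 hUp).2 ?_)
      · refine h2.mono fun r hr => ?_
        rcases mem_of_mem_rowInsert hr with rfl | h
        · right
          intro w hw
          simp only [List.tail_cons] at hUd
          cases hUd with
          | nil => simp at hw
          | cons hab _ =>
            rcases List.mem_cons.1 hw with rfl | hw
            · exact hab
            · have := (List.pairwise_cons.1 (List.pairwise_cons.1 hUp).2).1 w hw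
              omega
        · exact .inl h
      · simp only [List.tail_cons] at hUd
        cases hUd with
        | nil => exact .nil _
        | cons _ h => exact h

theorem rowInsert_of_le {x : ℕ} {R : List ℕ} (h : ∀ r ∈ R, r ≤ x) :
    rowInsert x R = (R ++ [x], none) := by
  induction R with
  | nil => rfl
  | cons a R ih =>
    have := h a (by simp)
    simp [rowInsert, this.not_gt, ih fun r hr => h r (by simp [hr])]

theorem tail_domLE_of_col {d : ℕ} {D R : List ℕ} (hD : (d :: D).Pairwise (· > ·))
    (hR : R.Pairwise (· ≤ ·)) (hd : d ∈ R) : DomLE (rowInsertWord R D).2 (d :: D) := by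
  induction D generalizing d R with
  | nil => exact .nil _
  | cons x D ih =>
    have hxd : x < d := (List.pairwise_cons.1 hD).1 x (by simp)
    obtain ⟨u, hu, hud⟩ := exists_bumped_le hR hd hxd
    simp only [rowInsertWord, hu, Option.toList_some, List.cons_append, List.nil_append]
    exact .cons hud (ih (List.pairwise_cons.1 hD).2 (rowInsert_sorted x hR)
      (self_mem_rowInsert x R))

theorem DomLE.trans {A B C : List ℕ} (h : DomLE A B) (h' : DomLE B C) : DomLE A C := by
  induction h generalizing C with
  | nil => exact .nil _
  | cons h1 _ ih =>
    cases h' with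
    | cons h2 h3 => exact .cons (h1.trans h2) (ih h3)

theorem DomLE.tail {A B : List ℕ} (h : DomLE A B) : DomLE A.tail B.tail := by
  cases h with
  | nil => exact .nil _
  | cons _ h => exact h

/-- Insertion into a row of a sequence of columns, each dominating the previous one, starting from a
row into which the column `A` has just been inserted, which bumped the column `U`. -/
theorem rowInsertWord_cols {A U R : List ℕ} {C : List (List ℕ)}
    (hA : A.Pairwise (· > ·)) (hC : ∀ B ∈ C, B.Pairwise (· > ·))
    (hch : (A :: C).IsChain DomLE) (hR : R.Pairwise (· ≤ ·)) (hRA : ∀ r ∈ R, DomLE [r] A)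
    (hU : U.Pairwise (· > ·)) (hUR : Clears R A.tail U) (hUA : DomLE U A) :
    ∃ C' : List (List ℕ), (rowInsertWord R C.flatten).2 = C'.flatten ∧
      C'.map List.length = C.map (fun B => B.length - 1) ∧ (∀ B ∈ C', B.Pairwise (· > ·)) ∧
      (U :: C').IsChain DomLE ∧
      (rowInsertWord R C.flatten).1.length = R.length + C.countP fun B => 0 < B.length := by
  induction C generalizing A U R with
  | nil => exact ⟨[], by simp [rowInsertWord]⟩
  | cons B C ih =>
    rw [List.isChain_cons_cons] at hch
    have hB := hC B (by simp)
    have hC' : ∀ B ∈ C, B.Pairwise (· > ·) := fun B' h => hC B' (by simp [h])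
    cases B with
    | nil =>
      -- Lengths weakly increase along the chain, so an empty column is preceded only by empty ones.
      have hA0 : A = [] := by
        cases hch.1; rfl
      subst hA0
      obtain ⟨C', h1, h2, h3, h4, h5⟩ := ih hA hC' hch.2 hR hRA hU hUR hUA
      have hU0 : U = [] := by cases hUA; rfl
      subst hU0
      refine ⟨[] :: C', by simpa using h1, by simpa using h2, by simpa using h3, ?_, by simpa using h5⟩
      rw [List.isChain_cons_cons]
      exact ⟨.nil _, h4⟩
    | cons b B =>
      -- The head `b` of the column is at least every letter of the row, so it is appended; all
      -- later letters of the column are below `b` and therefore bump. This accounts for one new box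
      -- in the row and one letter lost by the column.
      have hRb : ∀ r ∈ R, r ≤ b := by
        intro r hr
        have := (hRA r hr).trans hch.1
        cases this with
        | cons h _ => exact h
      have hR1 : (R ++ [b]).Pairwise (· ≤ ·) := by
        have := rowInsert_sorted b hR
        rwa [rowInsert_of_le hRb] at this
      have hb : b ∈ R ++ [b] := by simp
      obtain ⟨g1, g2, g3, g4, g5, g6⟩ := rowInsertWord_col hB hR1 hb
      have hUb : DomLE U (b :: B) := hUA.trans hch.1
      have hdom : DomLE U (rowInsertWord (R ++ [b]) B).2 := by
        refine domLE_bumped hB hR1 hb ?_ hU hUb.tail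
        refine (hUR.dom hch.1.tail).mono fun r hr => ?_
        rcases List.mem_append.1 hr with h | h
        · exact .inl h
        · right
          rw [List.mem_singleton] at h
          subst h
          intro u hu
          cases hUb with
          | nil => simp at hu
          | cons hab _ =>
            rcases List.mem_cons.1 hu with rfl | hu
            · exact hab
            · have := (List.pairwise_cons.1 hU).1 u hu
              omega
      obtain ⟨C', h1, h2, h3, h4, h5⟩ := ih hB hC' hch.2 (rowInsertWord_sorted B hR1) (by
          intro r hr
          refine .cons ?_ (.nil _)
          rcases g5 r hr with h | h
          · rcases List.mem_append.1 h with h | h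
            · exact hRb r h
            · simp at h; omega
          · exact ((List.pairwise_cons.1 hB).1 r h).le) g3 g6 (tail_domLE_of_col hB hR1 hb)
      refine ⟨(rowInsertWord (R ++ [b]) B).2 :: C', ?_, ?_, ?_, ?_, ?_⟩
      · simp [rowInsertWord, rowInsert_of_le hRb, rowInsertWord_append, h1]
      · simp [g2, h2]
      · simpa using ⟨g3, h3⟩
      · rw [List.isChain_cons_cons]
        exact ⟨hdom, h4⟩
      · simp [rowInsertWord, rowInsert_of_le hRb, rowInsertWord_append, h5, g1]
        omega

/-! ### Conjugate partitions, insertion shapes and sums of squares. -/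

/-- The conjugate of the partition obtained by sorting `α`. -/
def conjParts (α : List ℕ) : List ℕ :=
  (List.range (α.foldr max 0)).map fun j => α.countP (j < ·)

theorem le_foldr_max {α : List ℕ} {x : ℕ} (hx : x ∈ α) : x ≤ α.foldr max 0 := by
  induction α with
  | nil => simp at hx
  | cons a α ih =>
    rcases List.mem_cons.1 hx with rfl | h
    · simp
    · have := ih h; simp; omega

theorem foldr_max_map_pred (α : List ℕ) :
    (α.map (· - 1)).foldr max 0 = α.foldr max 0 - 1 := by
  induction α with
  | nil => rfl
  | cons a α ih => simp [ih]; omega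

/-- The recursion mirrors one row of insertion: the row has one box per nonempty column, and every
nonempty column is shortened by one. -/
theorem conjParts_cons {α : List ℕ} (h : α.foldr max 0 ≠ 0) :
    conjParts α = α.countP (0 < ·) :: conjParts (α.map (· - 1)) := by
  obtain ⟨m, hm⟩ := Nat.exists_eq_succ_of_ne_zero h
  rw [conjParts, conjParts, foldr_max_map_pred, hm, Nat.succ_eq_add_one, List.range_succ_eq_map]
  simp only [List.map_cons, List.map_map, Nat.add_sub_cancel, List.cons.injEq, true_and]
  congr 1
  funext j
  simp only [Function.comp, List.countP_map, Nat.succ_eq_add_one]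
  congr 1
  funext x
  simp only [Function.comp, decide_eq_decide]
  omega

/-- The shape of the insertion tableau of a sequence of columns, each dominating the previous one. -/
theorem insertionTableau_cols {C : List (List ℕ)} (hC : ∀ B ∈ C, B.Pairwise (· > ·))
    (hch : C.IsChain DomLE) :
    (insertionTableau C.flatten).map List.length = conjParts (C.map List.length) := by
  induction hn : C.flatten.length using Nat.strong_induction_on generalizing C with
  | _ n ih =>
    by_cases h0 : C.flatten = []
    · have : (C.map List.length).foldr max 0 = 0 := by
        clear hch hn
        rw [List.flatten_eq_nil_iff] at h0
        induction C with
        | nil => rfl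
        | cons B C ihC =>
          have := h0 B (by simp)
          subst this
          simpa using ihC (fun B h => hC B (by simp [h])) (fun B h => h0 B (by simp [h]))
      rw [h0, conjParts, this]; rfl
    -- An empty column in front of the chain, bumping the empty column, starts the row from nothing.
    · obtain ⟨C', h1, h2, h3, h4, h5⟩ := rowInsertWord_cols (A := []) (U := []) (R := []) (C := C)
        (by simp) hC (by
          cases C with
          | nil => simp
          | cons B C => rw [List.isChain_cons_cons]; exact ⟨.nil _, hch⟩) (by simp) (by simp)
          (by simp) (.nil _) (.nil _)
      have hm : (C.map List.length).foldr max 0 ≠ 0 := by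
        intro hm
        apply h0
        rw [List.flatten_eq_nil_iff]
        intro B hB
        have := le_foldr_max (List.mem_map_of_mem (f := List.length) hB)
        exact List.length_eq_zero_iff.1 (by omega)
      rw [insertionTableau_eq_cons h0, conjParts_cons hm, List.map_cons, h5, h1]
      have hlt := length_bumped_nil_lt h0
      rw [h1, hn] at hlt
      rw [ih _ hlt h3 h4.tail rfl, h2]
      simp only [List.length_nil, zero_add, List.countP_map, List.map_map]
      rfl

/-- Since `a ^ 2` is the sum of `2 * j + 1` over `j < a`, the sum of squares depends only on the
conjugate partition. It is thus a numerical invariant of the insertion shape. -/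
theorem sum_sq_eq (α : List ℕ) (M : ℕ) (hM : ∀ x ∈ α, x ≤ M) :
    (α.map (· ^ 2)).sum =
      ∑ j ∈ Finset.range M, (2 * j + 1) * α.countP (j < ·) := by
  induction α with
  | nil => simp
  | cons a α ih =>
    have ha : a ≤ M := hM a (by simp)
    have : ∑ j ∈ Finset.range M, (2 * j + 1) * (if j < a then 1 else 0) = a ^ 2 := by
      simp only [mul_ite, mul_one, mul_zero]
      rw [← Finset.sum_filter]
      have : (Finset.range M).filter (· < a) = Finset.range a := by
        ext j; simp; omega
      rw [this]
      clear * -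
      induction a with
      | zero => simp
      | succ a ih => rw [Finset.sum_range_succ, ih]; ring
    simp only [List.map_cons, List.sum_cons, List.countP_cons, mul_add, Finset.sum_add_distrib,
      ih fun x hx => hM x (by simp [hx])]
    simp only [decide_eq_true_eq, this]
    omega

theorem sum_sq_eq_of_conjParts_eq {α β : List ℕ} (h : conjParts α = conjParts β) :
    (α.map (· ^ 2)).sum = (β.map (· ^ 2)).sum := by
  have hM : α.foldr max 0 = β.foldr max 0 := by
    simpa [conjParts] using congrArg List.length h
  rw [sum_sq_eq α _ fun _ => le_foldr_max, sum_sq_eq β _ fun _ => le_foldr_max, ← hM]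
  refine Finset.sum_congr rfl fun j hj => ?_
  rw [conjParts, conjParts, ← hM] at h
  have := List.map_inj_left.1 h j (List.mem_range.2 (Finset.mem_range.1 hj))
  rw [this]

theorem conjParts_eq_of_perm {α β : List ℕ} (h : α.Perm β) : conjParts α = conjParts β := by
  have hM : α.foldr max 0 = β.foldr max 0 := h.foldr_eq 0
  rw [conjParts, conjParts, hM]
  congr 1
  funext j
  exact h.countP_eq _

theorem countP_lt_of_sorted {α : List ℕ} (h : α.Pairwise (· ≥ ·)) (i j : ℕ) :
    i < α.countP (j < ·) ↔ ∃ hi : i < α.length, j < α[i] := by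
  induction α generalizing i with
  | nil => simp
  | cons a α ih =>
    rw [List.pairwise_cons] at h
    rw [List.countP_cons]
    by_cases ha : j < a
    · simp only [ha, decide_true, if_true]
      cases i with
      | zero => simp [ha]
      | succ i => simpa using ih h.2 i
    · have : α.countP (j < ·) = 0 := by
        rw [List.countP_eq_zero]
        intro b hb
        have := h.1 b hb
        simp; omega
      simp only [this, ha]
      constructor
      · intro h; simp at h
      · rintro ⟨hi, hj⟩
        exfalso
        have : (a :: α)[i] ≤ a := by
          rcases List.mem_cons.1 (List.getElem_mem hi) with h' | h'
          · omega
          · exact h.1 _ h'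
        omega

theorem colLen_sortDiagram (α : List ℕ) (j : ℕ) :
    (sortDiagram α).colLen j = α.countP (j < ·) := by
  have hp := List.perm_insertionSort (· ≥ ·) α
  rw [← hp.countP_eq]
  have hs := List.pairwise_insertionSort (· ≥ ·) α
  refine eq_of_forall_lt_iff fun i => ?_
  rw [countP_lt_of_sorted hs, ← YoungDiagram.mem_iff_lt_colLen, sortDiagram,
    YoungDiagram.mem_ofRowLens]

/-- This translates the shape in the definition of frank words into counts, which do not involve
sorting. -/
theorem rowLens_transpose_sortDiagram (α : List ℕ) :
    (sortDiagram α).transpose.rowLens = conjParts α := by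
  have h0 : (sortDiagram α).rowLen 0 = α.foldr max 0 := by
    refine eq_of_forall_lt_iff fun j => ?_
    rw [← YoungDiagram.mem_iff_lt_rowLen, YoungDiagram.mem_iff_lt_colLen, colLen_sortDiagram,
      List.countP_pos_iff]
    constructor
    · rintro ⟨x, hx, hj⟩
      have := le_foldr_max hx
      simp at hj; omega
    · intro h
      by_contra hne
      push Not at hne
      have : α.foldr max 0 ≤ j := by
        clear h
        induction α with
        | nil => simp
        | cons a α ih =>
          have := hne a (by simp)
          have := ih fun x hx => hne x (by simp [hx])
          simp at *; omega
      omega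
  rw [YoungDiagram.rowLens, conjParts, YoungDiagram.colLen_transpose, h0]
  congr 1
  funext j
  rw [YoungDiagram.rowLen_transpose, colLen_sortDiagram]


/-! ### Sliding letters between adjacent columns by Knuth moves. -/

theorem Knuth.append_left (u : List ℕ) {v w : List ℕ} (h : Knuth v w) : Knuth (u ++ v) (u ++ w) :=
  (Knuth.refl u).append h

theorem Knuth.append_right (u : List ℕ) {v w : List ℕ} (h : Knuth v w) : Knuth (v ++ u) (w ++ u) :=
  h.append (Knuth.refl u)

theorem Knuth.cons (a : ℕ) {v w : List ℕ} (h : Knuth v w) : Knuth (a :: v) (a :: w) :=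
  h.append_left [a]

/-- A letter moves to the left past a column of smaller letters. -/
theorem knuth_move_left {a b : ℕ} {X : List ℕ} (hX : (a :: X).Pairwise (· > ·)) (hab : a ≤ b) :
    Knuth (a :: (X ++ [b])) (a :: b :: X) := by
  induction X generalizing a with
  | nil => exact .refl _
  | cons x X ih =>
    have hxa : x < a := (List.pairwise_cons.1 hX).1 x (by simp)
    have h1 := (ih (List.pairwise_cons.1 hX).2 (by omega)).cons a
    exact h1.trans ((Knuth.yxz hxa hab).append_right X)

/-- A letter moves to the right past a column of larger letters. -/
theorem knuth_move_right {a b : ℕ} {X : List ℕ} (hX : (X ++ [b]).Pairwise (· > ·)) (hab : a ≤ b) :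
    Knuth (a :: (X ++ [b])) (X ++ [a, b]) := by
  induction X with
  | nil => exact .refl _
  | cons x X ih =>
    have hX' := List.pairwise_cons.1 hX
    have h1 := (ih hX'.2).cons x
    refine Knuth.trans ?_ h1
    cases X with
    | nil =>
      exact (Knuth.xzy hab (hX'.1 b (by simp))).append_right []
    | cons y X =>
      have hyb : b ≤ y := ((List.pairwise_cons.1 hX'.2).1 b (by simp)).le
      exact (Knuth.xzy (hab.trans hyb) (hX'.1 y (by simp))).append_right (X ++ [b])

/-- Column insertion of a letter into a column from the right. -/
theorem knuth_column_insert {b : ℕ} {A : List ℕ} (hA : A.Pairwise (· > ·))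
    (hb : ∃ a ∈ A, a ≤ b) :
    ∃ a A₁ A₂, A = A₁ ++ a :: A₂ ∧ a ≤ b ∧ (∀ x ∈ A₁, b < x) ∧
      Knuth (A ++ [b]) (a :: (A₁ ++ b :: A₂)) := by
  induction A with
  | nil => simp at hb
  | cons x A ih =>
    rw [List.pairwise_cons] at hA
    by_cases hx : x ≤ b
    · refine ⟨x, [], A, rfl, hx, by simp, ?_⟩
      exact knuth_move_left (List.pairwise_cons.2 hA) hx
    · obtain ⟨a, A₁, A₂, rfl, hab, hA₁, hK⟩ := ih hA.2 (by
        obtain ⟨a, ha, hab⟩ := hb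
        rcases List.mem_cons.1 ha with rfl | ha
        · omega
        · exact ⟨a, ha, hab⟩)
      refine ⟨a, x :: A₁, A₂, rfl, hab, ?_, ?_⟩
      · intro y hy
        rcases List.mem_cons.1 hy with rfl | hy
        · omega
        · exact hA₁ y hy
      · refine (hK.cons x).trans ?_
        have hax : a < x := hA.1 a (by simp)
        cases A₁ with
        | nil => exact (Knuth.symm (Knuth.xzy hab (by omega))).append_right A₂
        | cons y A₁ =>
          have hby := hA₁ y (by simp)
          exact (Knuth.symm (Knuth.xzy (by omega : a ≤ y) (hA.1 y (by simp)))).append_right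
            (A₁ ++ b :: A₂)

/-- Column insertion of a letter into a column from the left. -/
theorem knuth_column_insert_left {a : ℕ} {B : List ℕ} (hB : B.Pairwise (· > ·))
    (ha : ∃ b ∈ B, a ≤ b) :
    ∃ b B₁ B₂, B = B₁ ++ b :: B₂ ∧ a ≤ b ∧ (∀ x ∈ B₂, x < a) ∧
      Knuth (a :: B) (B₁ ++ a :: B₂ ++ [b]) := by
  induction B using List.reverseRecOn with
  | nil => simp at ha
  | append_singleton B x ih =>
    by_cases hx : a ≤ x
    · refine ⟨x, B, [], rfl, hx, by simp, ?_⟩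
      simpa using knuth_move_right hB hx
    · have hB' := List.pairwise_append.1 hB
      obtain ⟨b, B₁, B₂, rfl, hab, hB₂, hK⟩ := ih hB'.1 (by
        obtain ⟨b, hb, hab⟩ := ha
        rcases List.mem_append.1 hb with hb | hb
        · exact ⟨b, hb, hab⟩
        · simp at hb; omega)
      refine ⟨b, B₁, B₂ ++ [x], by simp, hab, ?_, ?_⟩
      · intro y hy
        rcases List.mem_append.1 hy with hy | hy
        · exact hB₂ y hy
        · simp at hy; omega
      · refine (hK.append_right [x]).trans ?_
        have hxb : x < b := hB'.2.2 b (by simp) x (by simp)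
        rcases List.eq_nil_or_concat B₂ with rfl | ⟨B₂, y, rfl⟩
        · simpa using (Knuth.yxz (show x < a by omega) hab).append_left B₁ |>.symm
        · have hya := hB₂ y (by simp)
          have hxy : x < y := hB'.2.2 y (by simp) x (by simp)
          have := (Knuth.yxz hxy (show y ≤ b by omega)).append_left (B₁ ++ a :: B₂)
          simpa using this.symm

theorem countP_middle (p : ℕ → Bool) (A₁ A₂ : List ℕ) (a : ℕ) :
    (A₁ ++ a :: A₂).countP p = A₁.countP p + A₂.countP p + if p a then 1 else 0 := by
  simp [List.countP_append, List.countP_cons]; omega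

/-- Only the last letter `c` of `A` matters: it is the least, so `c ≤ b`, and `c` followed by `X` is
a column past which `b` moves. -/
theorem knuth_move_past_small {A X : List ℕ} {b : ℕ} (hA : A.Pairwise (· > ·))
    (hX : X.Pairwise (· > ·)) (hXA : ∀ x ∈ X, ∀ a ∈ A, x < a) (hb : ∃ a ∈ A, a ≤ b) :
    Knuth (A ++ (X ++ [b])) (A ++ b :: X) := by
  obtain ⟨a, ha, hab⟩ := hb
  rcases List.eq_nil_or_concat A with rfl | ⟨A, c, rfl⟩
  · simp at ha
  · rw [List.concat_eq_append] at *
    have hcb : c ≤ b := by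
      rcases List.mem_append.1 ha with h | h
      · have := (List.pairwise_append.1 hA).2.2 a h c (by simp); omega
      · simp at h; omega
    have := knuth_move_left (List.pairwise_cons.2 ⟨fun x hx => hXA x hx c (by simp), hX⟩) hcb
    simpa using this.append_left A

theorem knuth_move_past_large {B : List ℕ} {a x : ℕ} (hx : ∀ b ∈ B, b < x)
    (ha : ∃ b ∈ B, a ≤ b) (hB : B.Pairwise (· > ·)) :
    Knuth (a :: x :: B) (x :: a :: B) := by
  obtain ⟨b, hb, hab⟩ := ha
  cases B with
  | nil => simp at hb
  | cons c B =>
    have hac : a ≤ c := by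
      rcases List.mem_cons.1 hb with rfl | h
      · exact hab
      · have := (List.pairwise_cons.1 hB).1 b h; omega
    exact (Knuth.xzy hac (hx c (by simp))).append_right B

/-- The columns `A`, `B` slide past a column `X` of smaller letters. -/
theorem knuth_slide_small {A X B : List ℕ} (hA : A.Pairwise (· > ·)) (hB : B.Pairwise (· > ·))
    (hX : X.Pairwise (· > ·)) (hXA : ∀ x ∈ X, ∀ a ∈ A, x < a) (hXB : ∀ x ∈ X, ∀ b ∈ B, x < b)
    (hAB : ∀ t, B.countP (· ≤ t) ≤ A.countP (· ≤ t)) :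
    Knuth (A ++ X ++ B) (A ++ B ++ X) := by
  induction B generalizing A with
  | nil => simpa using Knuth.refl _
  | cons b B ih =>
    rw [List.pairwise_cons] at hB
    have hex : ∃ a ∈ A, a ≤ b := by
      have h1 := hAB b
      have h2 : 0 < A.countP (· ≤ b) := by
        refine lt_of_lt_of_le ?_ h1
        rw [List.countP_pos_iff]
        exact ⟨b, by simp⟩
      simpa using List.countP_pos_iff.1 h2
    obtain ⟨a, A₁, A₂, rfl, hab, hA₁, hK⟩ := knuth_column_insert hA hex
    have hApp := List.pairwise_append.1 hA
    have hA2 := List.pairwise_cons.1 hApp.2.1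
    have hA' : (A₁ ++ b :: A₂).Pairwise (· > ·) := by
      refine List.pairwise_append.2 ⟨hApp.1, List.pairwise_cons.2 ⟨fun y hy => ?_, hA2.2⟩, ?_⟩
      · have := hA2.1 y hy; omega
      · intro y hy z hz
        rcases List.mem_cons.1 hz with rfl | hz
        · exact hA₁ y hy
        · exact hApp.2.2 y hy z (by simp [hz])
    have key := ih hA' hB.2 (by
        intro x hx c hc
        have h1 := hXB x hx b (by simp)
        rcases List.mem_append.1 hc with hc | hc
        · exact hXA x hx c (by simp [hc])
        · rcases List.mem_cons.1 hc with rfl | hc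
          · exact h1
          · exact hXA x hx c (by simp [hc])) (fun x hx c hc => hXB x hx c (by simp [hc])) (by
        intro t
        have h1 := hAB t
        have h2 := hAB b
        rw [countP_middle] at h1 h2 ⊢
        rw [List.countP_cons] at h1 h2
        simp only [decide_eq_true_eq] at h1 h2 ⊢
        by_cases htb : b ≤ t
        · simp only [htb, if_true, show a ≤ t by omega] at h1 ⊢; omega
        · by_cases hta : a ≤ t
          -- Here `a ≤ t < b`, so replacing `a` by `b` costs `A` one letter counted at `t`. The
          -- hypothesis at `b` compensates: the letters of `A` up to `b` are `a` and those of `A₂`,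
          -- and the latter are all below `a`.
          · simp only [htb, if_false]
            simp only [le_refl, if_true, hab] at h2
            have h3 : A₁.countP (· ≤ b) = 0 := by
              rw [List.countP_eq_zero]
              intro y hy
              have := hA₁ y hy
              simp; omega
            have h4 : A₂.countP (· ≤ b) = A₂.countP (· ≤ t) := by
              apply List.countP_congr
              intro y hy
              have := hA2.1 y hy
              simp; omega
            have h5 : B.countP (· ≤ t) ≤ B.countP (· ≤ b) := by
              apply List.countP_mono_left
              intro y _
              simp; omega
            omega
          · simp only [htb, hta, if_false] at h1 ⊢
            exact h1)
    -- The route: `b` passes `X` and is inserted into `A`, ejecting `a` to the left; the rest of `B`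
    -- slides by induction; then the insertion of `b` is undone.
    have h1 := (knuth_move_past_small hA hX hXA hex).append_right B
    have h2 := (hK.append_right (X ++ B))
    have h3 := key.cons a
    have h4 := (hK.append_right (B ++ X)).symm
    simp only [List.append_assoc, List.cons_append, List.nil_append] at h1 h2 h3 h4 ⊢
    exact h1.trans (h2.trans (h3.trans h4))

/-- A letter larger than the columns `A`, `B` slides past `A`. -/
theorem knuth_slide_large {A B : List ℕ} {x : ℕ} (hA : A.Pairwise (· > ·))
    (hB : B.Pairwise (· > ·)) (hxA : ∀ a ∈ A, a < x) (hxB : ∀ b ∈ B, b < x)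
    (hAB : ∀ t, A.countP (t ≤ ·) ≤ B.countP (t ≤ ·)) :
    Knuth (x :: (A ++ B)) (A ++ x :: B) := by
  induction A using List.reverseRecOn generalizing B with
  | nil => exact .refl _
  | append_singleton A a ih =>
    have hApp := List.pairwise_append.1 hA
    have hex : ∃ b ∈ B, a ≤ b := by
      have h1 := hAB a
      have h2 : 0 < B.countP (a ≤ ·) := by
        refine lt_of_lt_of_le ?_ h1
        rw [List.countP_pos_iff]
        exact ⟨a, by simp⟩
      simpa using List.countP_pos_iff.1 h2
    have hmove := knuth_move_past_large hxB hex hB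
    obtain ⟨b, B₁, B₂, rfl, hab, hB₂, hK⟩ := knuth_column_insert_left hB hex
    have hBpp := List.pairwise_append.1 hB
    have hB2 := List.pairwise_cons.1 hBpp.2.1
    have hB' : (B₁ ++ a :: B₂).Pairwise (· > ·) := by
      refine List.pairwise_append.2 ⟨hBpp.1, List.pairwise_cons.2 ⟨hB₂, hB2.2⟩, ?_⟩
      intro y hy z hz
      have := hBpp.2.2 y hy b (by simp)
      rcases List.mem_cons.1 hz with rfl | hz
      · omega
      · exact hBpp.2.2 y hy z (by simp [hz])
    have key := ih hApp.1 hB' (fun c hc => hxA c (by simp [hc])) (by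
        intro c hc
        rcases List.mem_append.1 hc with hc | hc
        · exact hxB c (by simp [hc])
        · rcases List.mem_cons.1 hc with rfl | hc
          · exact hxA c (by simp)
          · exact hxB c (by simp [hc])) (by
        intro t
        have h1 := hAB t
        have h2 := hAB a
        rw [List.countP_append, List.countP_singleton, countP_middle] at h1 h2
        rw [countP_middle]
        simp only [decide_eq_true_eq] at h1 h2 ⊢
        by_cases hta : t ≤ a
        · simp only [hta, if_true, show t ≤ b by omega] at h1 ⊢; omega
        · by_cases htb : t ≤ b
          · simp only [hta, if_false]
            simp only [le_refl, if_true, hab] at h2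
            have h3 : B₂.countP (a ≤ ·) = 0 := by
              rw [List.countP_eq_zero]
              intro y hy
              have := hB₂ y hy
              simp; omega
            have h4 : B₁.countP (a ≤ ·) = B₁.countP (t ≤ ·) := by
              apply List.countP_congr
              intro y hy
              have := hBpp.2.2 y hy b (by simp)
              simp; omega
            have h5 : A.countP (t ≤ ·) ≤ A.countP (a ≤ ·) := by
              apply List.countP_mono_left
              intro y _
              simp; omega
            omega
          · simp only [htb, hta, if_false] at h1 ⊢
            exact h1)
    -- The mirror route: `a` is inserted into `B`, ejecting `b` to the right; `x` passes the shorter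
    -- `A` by induction; the insertion is undone, and `x` passes `a`.
    have h1 := (hK.append_left (x :: A))
    have h2 := key.append_right [b]
    have h3 := (hK.append_left (A ++ [x])).symm
    have h4 := hmove.symm.append_left A
    simp only [List.append_assoc, List.cons_append, List.nil_append] at h1 h2 h3 h4 ⊢
    exact h1.trans (h2.trans (h3.trans h4))

/-- A letter `x` slides from the left column to the right column. -/
theorem knuth_slide {A₁ A₂ B₁ B₂ : List ℕ} {x : ℕ} (hA : (A₁ ++ x :: A₂).Pairwise (· > ·))
    (hB : (B₁ ++ x :: B₂).Pairwise (· > ·))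
    (h₁ : ∀ t, B₁.countP (· ≤ t) ≤ A₁.countP (· ≤ t))
    (h₂ : ∀ t, A₂.countP (t ≤ ·) ≤ B₂.countP (t ≤ ·)) :
    Knuth (A₁ ++ x :: A₂ ++ (B₁ ++ B₂)) (A₁ ++ A₂ ++ (B₁ ++ x :: B₂)) := by
  have hA' := List.pairwise_append.1 hA
  have hB' := List.pairwise_append.1 hB
  have hA2 := List.pairwise_cons.1 hA'.2.1
  have hB2 := List.pairwise_cons.1 hB'.2.1
  have hxA : ∀ a ∈ A₁, x < a := fun a ha => hA'.2.2 a ha x (by simp)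
  have hxB : ∀ a ∈ B₁, x < a := fun a ha => hB'.2.2 a ha x (by simp)
  -- The slide has three stages: `x A₂` trades places with `B₁`, then `x` crosses `A₂`, then `A₂`
  -- trades back with `B₁`.
  have k1 := knuth_slide_small hA'.1 hB'.1 hA'.2.1 (fun y hy a ha => hA'.2.2 a ha y hy) (by
    intro y hy b hb
    have := hxB b hb
    rcases List.mem_cons.1 hy with rfl | hy
    · exact this
    · have := hA2.1 y hy; omega) h₁
  have k2 := knuth_slide_small hA'.1 hB'.1 hA2.2 (fun y hy a ha => hA'.2.2 a ha y (by simp [hy])) (by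
    intro y hy b hb
    have := hxB b hb
    have := hA2.1 y hy; omega) h₁
  have k3 := knuth_slide_large hA2.2 hB2.2 hA2.1 hB2.1 h₂
  have k1' := k1.append_right B₂
  have k2' := (k2.append_right (x :: B₂)).symm
  have k3' := k3.append_left (A₁ ++ B₁)
  simp only [List.append_assoc, List.cons_append] at k1' k2' k3' ⊢
  exact k1'.trans (k3'.trans k2')

/-! ### Knuth invariance of the suffix condition. -/

theorem antitone_iff_succ_le {f : ℕ → ℕ} : Antitone f ↔ ∀ n, f (n + 1) ≤ f n :=
  ⟨fun h n => h n.le_succ, antitone_nat_of_succ_le⟩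

/-- The suffix condition in the definition of compatible words, for words added to the
partition with column heights `h`. -/
def SuffixPartition (h : ℕ → ℕ) (w : List ℕ) : Prop :=
  ∀ u, u <:+ w → Antitone fun c => u.count (c + 1) + h c

theorem suffixPartition_cons {h : ℕ → ℕ} {a : ℕ} {w : List ℕ} :
    SuffixPartition h (a :: w) ↔
      (Antitone fun c => (a :: w).count (c + 1) + h c) ∧ SuffixPartition h w := by
  simp only [SuffixPartition, List.suffix_cons_iff, forall_eq_or_imp]

theorem suffixPartition_append {h : ℕ → ℕ} {v w : List ℕ} :
    SuffixPartition h (v ++ w) ↔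
      SuffixPartition (fun c => w.count (c + 1) + h c) v ∧ SuffixPartition h w := by
  induction v with
  | nil =>
    constructor
    · intro hw
      refine ⟨?_, hw⟩
      intro u hu
      have : u = [] := by simpa using hu
      subst this
      simpa using hw w (List.suffix_refl w)
    · exact fun hw => hw.2
  | cons a v ih =>
    rw [List.cons_append, suffixPartition_cons, suffixPartition_cons, ih, and_assoc]
    have : (fun c => (a :: (v ++ w)).count (c + 1) + h c) =
        fun c => (a :: v).count (c + 1) + (w.count (c + 1) + h c) := by
      funext c
      simp only [List.count_cons, List.count_append]
      omega
    rw [this]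

theorem suffixPartition_triple {h : ℕ → ℕ} {x y z : ℕ} :
    SuffixPartition h [x, y, z] ↔ (Antitone h) ∧ (Antitone fun c => [z].count (c + 1) + h c) ∧
      (Antitone fun c => [y, z].count (c + 1) + h c) ∧
      (Antitone fun c => [x, y, z].count (c + 1) + h c) := by
  rw [suffixPartition_cons, suffixPartition_cons, suffixPartition_cons]
  have : SuffixPartition h [] ↔ Antitone h := by
    simp [SuffixPartition]
  rw [this]
  tauto

/-- `suffixPartition_append` absorbs everything to the right of a move into the heights, and
equivalent words have equal counts. With arbitrary heights allowed, it remains to check the two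
elementary moves, where the inequalities for each pair of neighbouring columns decide. -/
theorem Knuth.suffixPartition_iff {v w : List ℕ} (hK : Knuth v w) (h : ℕ → ℕ) :
    SuffixPartition h v ↔ SuffixPartition h w := by
  induction hK generalizing h with
  | refl w => rfl
  | symm _ ih => exact (ih h).symm
  | trans _ _ ih1 ih2 => exact (ih1 h).trans (ih2 h)
  | @append v v' w w' _ k2 ih1 ih2 =>
    rw [suffixPartition_append, suffixPartition_append, ih2, ih1]
    simp only [k2.perm.count_eq]
  | @yxz x y z hxy hyz =>
    rw [suffixPartition_triple, suffixPartition_triple]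
    simp only [antitone_iff_succ_le, List.count_cons, List.count_nil, beq_iff_eq]
    constructor <;> rintro ⟨h0, h1, h2, h3⟩ <;> refine ⟨h0, ?_, ?_, ?_⟩ <;> intro c <;>
      specialize h0 c <;> specialize h1 c <;> specialize h2 c <;> specialize h3 c <;>
      split_ifs at * <;> omega
  | @xzy x y z hxy hyz =>
    rw [suffixPartition_triple, suffixPartition_triple]
    simp only [antitone_iff_succ_le, List.count_cons, List.count_nil, beq_iff_eq]
    constructor <;> rintro ⟨h0, h1, h2, h3⟩ <;> refine ⟨h0, ?_, ?_, ?_⟩ <;> intro c <;>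
      specialize h0 c <;> specialize h1 c <;> specialize h2 c <;> specialize h3 c <;>
      split_ifs at * <;> omega


/-! ### Bracketing, crystal reflections and ballot conditions. -/

/-- Words in which every letter `i + 1` is paired with a letter `i` and conversely. -/
inductive Balanced (i : ℕ) : List ℕ → Prop
  | nil : Balanced i []
  | other {a : ℕ} {w : List ℕ} : a ≠ i → a ≠ i + 1 → Balanced i w → Balanced i (a :: w)
  | pair {u w : List ℕ} : Balanced i u → Balanced i w → Balanced i ((i + 1) :: (u ++ i :: w))

/-- The blocks `us`, each preceded by a letter: `i` for the first `k` of them, `i + 1` for the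
others. -/
def fillWord (i : ℕ) : ℕ → List (List ℕ) → List ℕ
  | _, [] => []
  | 0, u :: us => (i + 1) :: (u ++ fillWord i 0 us)
  | k + 1, u :: us => i :: (u ++ fillWord i k us)

/-- Induction from the right. A new `i` is unpaired and opens a block. A new `i + 1` pairs with the
first unpaired `i`, merging the two balanced words around it, or is unpaired if there is none. In
this normal form, the `k` unpaired `i` precede all unpaired `i + 1`. -/
theorem exists_blocks (i : ℕ) (v : List ℕ) :
    ∃ u us k, Balanced i u ∧ (∀ u' ∈ us, Balanced i u') ∧ k ≤ us.length ∧
      v = u ++ fillWord i k us := by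
  induction v with
  | nil => exact ⟨[], [], 0, .nil, by simp, by simp, rfl⟩
  | cons a v ih =>
    obtain ⟨u, us, k, hu, hus, hk, rfl⟩ := ih
    by_cases h1 : a = i
    · subst h1
      exact ⟨[], u :: us, k + 1, .nil, by simpa using ⟨hu, hus⟩, by simpa using hk, rfl⟩
    by_cases h2 : a = i + 1
    · subst h2
      cases k with
      | zero => exact ⟨[], u :: us, 0, .nil, by simpa using ⟨hu, hus⟩, by simp, rfl⟩
      | succ k =>
        cases us with
        | nil => simp at hk
        | cons u' us =>
          refine ⟨(i + 1) :: (u ++ i :: u'), us, k, .pair hu (hus u' (by simp)),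
            fun w hw => hus w (by simp [hw]), by simpa using hk, ?_⟩
          simp [fillWord]
    · exact ⟨a :: u, us, k, .other h1 h2 hu, hus, hk, rfl⟩

/-- A word all of whose letters `i`, `i + 1` are flagged as paired. -/
def allPaired (i : ℕ) (u : List ℕ) : List (ℕ × Bool) :=
  u.map fun a => (a, decide (a = i ∨ a = i + 1))

theorem markFirst_allPaired (i : ℕ) (u : List ℕ) (F : List (ℕ × Bool)) :
    markFirst i (allPaired i u ++ (i, false) :: F) = allPaired i u ++ (i, true) :: F := by
  induction u with
  | nil => simp [allPaired, markFirst]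
  | cons a u ih =>
    simp only [allPaired, List.map_cons, List.cons_append, markFirst] at ih ⊢
    rw [if_neg, ih]
    simp
    tauto

theorem Balanced.pairLetters_append {i : ℕ} {u : List ℕ} (hu : Balanced i u) (v : List ℕ) :
    pairLetters i (u ++ v) = allPaired i u ++ pairLetters i v := by
  induction hu generalizing v with
  | nil => rfl
  | other h1 h2 _ ih => simp [pairLetters, h1, h2, ih, allPaired]
  | @pair u w _ _ ih1 ih2 =>
    have h : pairLetters i (u ++ i :: w ++ v) =
        allPaired i u ++ (i, false) :: (allPaired i w ++ pairLetters i v) := by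
      simp [ih1, ih2, pairLetters]
    rw [List.cons_append, pairLetters, h, if_pos (by simp), markFirst_allPaired]
    simp [allPaired]

/-- The flags of `fillWord`. -/
def fillFlags (i : ℕ) : ℕ → List (List ℕ) → List (ℕ × Bool)
  | _, [] => []
  | 0, u :: us => (i + 1, false) :: (allPaired i u ++ fillFlags i 0 us)
  | k + 1, u :: us => (i, false) :: (allPaired i u ++ fillFlags i k us)

theorem not_mem_allPaired (i a : ℕ) (u : List ℕ) (ha : a = i ∨ a = i + 1) :
    (a, false) ∉ allPaired i u := by
  simp [allPaired]
  tauto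

theorem not_mem_fillFlags_zero (i : ℕ) (us : List (List ℕ)) : (i, false) ∉ fillFlags i 0 us := by
  induction us with
  | nil => simp [fillFlags]
  | cons u us ih => simp [fillFlags, ih, not_mem_allPaired]

theorem pairLetters_fillWord {i k : ℕ} {us : List (List ℕ)} (hus : ∀ u ∈ us, Balanced i u) :
    pairLetters i (fillWord i k us) = fillFlags i k us := by
  induction us generalizing k with
  | nil => simp [fillWord, fillFlags, pairLetters]
  | cons u us ih =>
    have hu := hus u (by simp)
    have ih := fun k => ih (k := k) fun u' h => hus u' (by simp [h])
    cases k with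
    | zero =>
      rw [fillWord, pairLetters, hu.pairLetters_append, ih, if_neg, fillFlags]
      simp [not_mem_allPaired, not_mem_fillFlags_zero]
    | succ k =>
      rw [fillWord, pairLetters, hu.pairLetters_append, ih, if_neg, fillFlags]
      simp

theorem rewriteUnpaired_allPaired (i k : ℕ) (u : List ℕ) (F : List (ℕ × Bool)) :
    rewriteUnpaired i k (allPaired i u ++ F) = u ++ rewriteUnpaired i k F := by
  induction u with
  | nil => rfl
  | cons a u ih =>
    simp only [allPaired, List.map_cons, List.cons_append] at ih ⊢
    have h : ¬ ((a = i ∨ a = i + 1) ∧ decide (a = i ∨ a = i + 1) = false) := by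
      simp; tauto
    rw [rewriteUnpaired.eq_def]
    simp only [if_neg h, ih]

theorem rewriteUnpaired_fillFlags (i j k : ℕ) (us : List (List ℕ)) :
    rewriteUnpaired i j (fillFlags i k us) = fillWord i j us := by
  induction us generalizing j k with
  | nil => simp [fillFlags, fillWord, rewriteUnpaired]
  | cons u us ih =>
    cases k <;> cases j <;>
      simp [fillFlags, fillWord, rewriteUnpaired, rewriteUnpaired_allPaired, ih]

theorem count_fillFlags {i k : ℕ} {us : List (List ℕ)} (hk : k ≤ us.length) :
    (fillFlags i k us).count (i + 1, false) = us.length - k := by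
  induction us generalizing k with
  | nil => simp [fillFlags]
  | cons u us ih =>
    have h0 : (allPaired i u).count (i + 1, false) = 0 :=
      List.count_eq_zero.2 (not_mem_allPaired i (i + 1) u (.inr rfl))
    cases k with
    | zero => simp [fillFlags, h0, ih]
    | succ k =>
      simp at hk
      simp [fillFlags, h0, ih hk]

/-- Balanced parts are invisible to the bracketing, so the reflection only exchanges the numbers of
unpaired `i` and `i + 1`. Involutivity and the effect on content are read off from this form. -/
theorem reflectWord_blocks {i k : ℕ} {u : List ℕ} {us : List (List ℕ)} (hu : Balanced i u)
    (hus : ∀ u' ∈ us, Balanced i u') (hk : k ≤ us.length) :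
    reflectWord i (u ++ fillWord i k us) = u ++ fillWord i (us.length - k) us := by
  have h0 : (allPaired i u).count (i + 1, false) = 0 :=
    List.count_eq_zero.2 (not_mem_allPaired i (i + 1) u (.inr rfl))
  rw [reflectWord, hu.pairLetters_append, pairLetters_fillWord hus, List.count_append, h0,
    count_fillFlags hk, zero_add, rewriteUnpaired_allPaired, rewriteUnpaired_fillFlags]

theorem reflectWord_reflectWord (i : ℕ) (v : List ℕ) : reflectWord i (reflectWord i v) = v := by
  obtain ⟨u, us, k, hu, hus, hk, rfl⟩ := exists_blocks i v
  rw [reflectWord_blocks hu hus hk, reflectWord_blocks hu hus (by omega), Nat.sub_sub_self hk]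

/-- Every suffix has at least as many letters `i` as letters `i + 1`. -/
def SuffixBallot (i : ℕ) (w : List ℕ) : Prop :=
  ∀ u s, w = u ++ s → s.count (i + 1) ≤ s.count i

/-- Every prefix has at least as many letters `i + 1` as letters `i`. -/
def PrefixBallot (i : ℕ) (w : List ℕ) : Prop :=
  ∀ u s, w = u ++ s → u.count i ≤ u.count (i + 1)

theorem SuffixBallot.append {i : ℕ} {v w : List ℕ} (hv : SuffixBallot i v)
    (hw : SuffixBallot i w) : SuffixBallot i (v ++ w) := by
  intro u s hs
  rcases List.append_eq_append_iff.1 hs with ⟨t, rfl, rfl⟩ | ⟨t, rfl, rfl⟩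
  · exact hw _ _ rfl
  · have h1 := hv _ _ rfl
    have h2 := hw [] _ rfl
    simp only [List.count_append]
    omega

theorem PrefixBallot.append {i : ℕ} {v w : List ℕ} (hv : PrefixBallot i v)
    (hw : PrefixBallot i w) : PrefixBallot i (v ++ w) := by
  intro u s hs
  rcases List.append_eq_append_iff.1 hs with ⟨t, rfl, rfl⟩ | ⟨t, rfl, rfl⟩
  · have h1 := hv _ [] (List.append_nil _).symm
    have h2 := hw _ _ rfl
    simp only [List.count_append]
    omega
  · exact hv _ _ rfl

theorem SuffixBallot.cons {i a : ℕ} {w : List ℕ} (hw : SuffixBallot i w)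
    (h : (a :: w).count (i + 1) ≤ (a :: w).count i) : SuffixBallot i (a :: w) := by
  intro u s hs
  cases u with
  | nil => rw [List.nil_append] at hs; rwa [← hs]
  | cons b u =>
    rw [List.cons_append, List.cons.injEq] at hs
    exact hw u s hs.2

theorem Balanced.count_eq {i : ℕ} {u : List ℕ} (hu : Balanced i u) :
    u.count (i + 1) = u.count i := by
  induction hu with
  | nil => rfl
  | other h1 h2 _ ih => simp [h1, h2, ih]
  | pair _ _ ih1 ih2 => simp [ih1, ih2]; omega

theorem Balanced.suffixBallot {i : ℕ} {u : List ℕ} (hu : Balanced i u) : SuffixBallot i u := by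
  induction hu with
  | nil => intro u s h; simp_all
  | @other a w h1 h2 _ ih =>
    refine ih.cons ?_
    have := ih [] w rfl
    simpa [List.count_cons, h1, h2] using this
  | @pair u w hu hw ih1 ih2 =>
    refine (ih1.append (ih2.cons ?_)).cons (hu.pair hw).count_eq.le
    simp [hw.count_eq]

theorem Balanced.prefixBallot {i : ℕ} {u : List ℕ} (hu : Balanced i u) : PrefixBallot i u := by
  induction hu with
  | nil => intro u s h; simp_all
  | @other a w h1 h2 _ ih =>
    intro u s hs
    cases u with
    | nil => simp
    | cons b u =>
      rw [List.cons_append, List.cons.injEq] at hs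
      have := ih u s hs.2
      rw [← hs.1]
      simpa [List.count_cons, h1, h2] using this
  | @pair u w hu hw ih1 ih2 =>
    intro v s hs
    cases v with
    | nil => simp
    | cons b v =>
      rw [List.cons_append, List.cons.injEq] at hs
      rw [← hs.1]
      have key : v.count i ≤ v.count (i + 1) + 1 := by
        rcases List.append_eq_append_iff.1 hs.2 with ⟨t, rfl, h⟩ | ⟨t, rfl, rfl⟩
        · have h1 := ih1 u [] (List.append_nil _).symm
          cases t with
          | nil => simp; omega
          | cons c t =>
            rw [List.cons_append, List.cons.injEq] at h
            have h2 := ih2 t s h.2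
            rw [← h.1]
            simp
            omega
        · have := ih1 v t rfl; omega
      simp
      omega

theorem suffixBallot_fillWord {i : ℕ} {us : List (List ℕ)} (hus : ∀ u ∈ us, Balanced i u) :
    SuffixBallot i (fillWord i us.length us) := by
  induction us with
  | nil => exact Balanced.nil.suffixBallot
  | cons u us ih =>
    have h := (hus u (by simp)).suffixBallot.append (ih fun u' h => hus u' (by simp [h]))
    refine h.cons ?_
    have := h [] _ rfl
    simp at this ⊢
    omega

theorem prefixBallot_fillWord {i : ℕ} {us : List (List ℕ)} (hus : ∀ u ∈ us, Balanced i u) :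
    PrefixBallot i (fillWord i 0 us) := by
  induction us with
  | nil => exact Balanced.nil.prefixBallot
  | cons u us ih =>
    have h := (hus u (by simp)).prefixBallot.append (ih fun u' h => hus u' (by simp [h]))
    have h1 : PrefixBallot i [i + 1] := by
      intro v s hv
      cases v with
      | nil => simp
      | cons b v =>
        cases v with
        | nil => simp at hv; simp [← hv.1]
        | cons c v => simp at hv
    exact h1.append h

/-- Consecutive fillings differ in one letter. -/
theorem fillWord_succ {i k : ℕ} {us : List (List ℕ)} (hus : ∀ u ∈ us, Balanced i u)
    (hk : k < us.length) :
    ∃ P S, fillWord i k us = P ++ (i + 1) :: S ∧ fillWord i (k + 1) us = P ++ i :: S ∧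
      SuffixBallot i P ∧ PrefixBallot i S := by
  induction us generalizing k with
  | nil => simp at hk
  | cons u us ih =>
    have hu := hus u (by simp)
    have hus' : ∀ u ∈ us, Balanced i u := fun u' h => hus u' (by simp [h])
    cases k with
    | zero =>
      exact ⟨[], u ++ fillWord i 0 us, rfl, rfl, Balanced.nil.suffixBallot,
        hu.prefixBallot.append (prefixBallot_fillWord hus')⟩
    | succ k =>
      obtain ⟨P, S, h1, h2, h3, h4⟩ := ih hus' (by simpa using hk)
      refine ⟨i :: (u ++ P), S, by simp [fillWord, h1], by simp [fillWord, h2], ?_, h4⟩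
      have h := hu.suffixBallot.append h3
      refine h.cons ?_
      have := h [] _ rfl
      simp at this ⊢
      omega

theorem length_fillWord (i j k : ℕ) (us : List (List ℕ)) :
    (fillWord i j us).length = (fillWord i k us).length := by
  induction us generalizing j k with
  | nil => simp [fillWord]
  | cons u us ih =>
    cases j <;> cases k <;> simp [fillWord]
    all_goals exact ih _ _

theorem count_fillWord {i k : ℕ} {us : List (List ℕ)} (hk : k ≤ us.length) :
    (fillWord i k us).count i = us.flatten.count i + k ∧
      (fillWord i k us).count (i + 1) = us.flatten.count (i + 1) + (us.length - k) ∧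
      ∀ a, a ≠ i → a ≠ i + 1 → (fillWord i k us).count a = us.flatten.count a := by
  induction us generalizing k with
  | nil => simp at hk; simp [hk, fillWord]
  | cons u us ih =>
    cases k with
    | zero =>
      obtain ⟨h1, h2, h3⟩ := ih (k := 0) (by simp)
      refine ⟨by simp [fillWord, h1], by simp [fillWord, h2]; omega, fun a ha hb => ?_⟩
      simp [fillWord, h3 a ha hb, Ne.symm hb]
    | succ k =>
      obtain ⟨h1, h2, h3⟩ := ih (k := k) (by simpa using hk)
      refine ⟨by simp [fillWord, h1]; omega, by simp [fillWord, h2]; omega, fun a ha hb => ?_⟩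
      simp [fillWord, h3 a ha hb, Ne.symm ha]

theorem Balanced.count_flatten {i : ℕ} {us : List (List ℕ)} (hus : ∀ u ∈ us, Balanced i u) :
    us.flatten.count (i + 1) = us.flatten.count i := by
  induction us with
  | nil => rfl
  | cons u us ih =>
    simp [(hus u (by simp)).count_eq, ih fun u' h => hus u' (by simp [h])]

/-- Each replacement of `i + 1` by `i` lowers the sum by one; the sum is the termination measure of
`exists_shape`. -/
theorem sum_fillWord {i k : ℕ} {us : List (List ℕ)} (hk : k ≤ us.length) :
    (fillWord i k us).sum + k = (fillWord i 0 us).sum := by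
  induction us generalizing k with
  | nil => simp at hk; simp [hk, fillWord]
  | cons u us ih =>
    cases k with
    | zero => rfl
    | succ k =>
      have := ih (k := k) (by simpa using hk)
      simp [fillWord]
      omega


/-! ### Biwords: changing one entry is a Knuth equivalence of the column words. -/

/-- A biword: the list of pairs (column, entry) is ordered by increasing columns, and by decreasing
entries in each column. -/
def BiSorted (L : List (ℕ × ℕ)) : Prop :=
  L.Pairwise fun a b => a.1 < b.1 ∨ (a.1 = b.1 ∧ b.2 < a.2)

/-- The columns that contain the entry `e`, in decreasing order. -/
def colWord (L : List (ℕ × ℕ)) (e : ℕ) : List ℕ :=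
  ((L.filter fun a => a.2 = e).map Prod.fst).reverse

/-- The column words of the entries `n, …, 1`. -/
def colWords (L : List (ℕ × ℕ)) : ℕ → List (List ℕ)
  | 0 => []
  | n + 1 => colWord L (n + 1) :: colWords L n

theorem colWord_append (L L' : List (ℕ × ℕ)) (e : ℕ) :
    colWord (L ++ L') e = colWord L' e ++ colWord L e := by
  simp [colWord]

theorem colWord_cons_self (L : List (ℕ × ℕ)) (x e : ℕ) :
    colWord ((x, e) :: L) e = colWord L e ++ [x] := by
  simp [colWord]

theorem colWord_cons_ne (L : List (ℕ × ℕ)) {x e e' : ℕ} (h : e' ≠ e) :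
    colWord ((x, e') :: L) e = colWord L e := by
  simp [colWord, h]

theorem mem_colWord {L : List (ℕ × ℕ)} {c e : ℕ} : c ∈ colWord L e ↔ (c, e) ∈ L := by
  simp [colWord]

theorem length_colWord (L : List (ℕ × ℕ)) (e : ℕ) :
    (colWord L e).length = (L.map Prod.snd).count e := by
  rw [colWord, List.length_reverse, List.length_map, ← List.countP_eq_length_filter, List.count,
    List.countP_map]
  rfl

theorem BiSorted.colWord_sorted {L : List (ℕ × ℕ)} (h : BiSorted L) (e : ℕ) :
    (colWord L e).Pairwise (· > ·) := by
  rw [colWord, List.pairwise_reverse, List.pairwise_map, List.pairwise_filter]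
  refine h.imp fun {a b} hab ha hb => ?_
  simp at ha hb
  omega

theorem countP_colWord (L : List (ℕ × ℕ)) (e : ℕ) (p : ℕ → Bool) :
    (colWord L e).countP p = ((L.filter fun a => p a.1).map Prod.snd).count e := by
  induction L with
  | nil => rfl
  | cons a L ih =>
    obtain ⟨x, f⟩ := a
    by_cases hf : f = e
    · subst hf
      rw [colWord_cons_self, List.countP_append, ih, List.countP_singleton]
      by_cases hp : p x <;> simp [hp]
    · rw [colWord_cons_ne L hf, ih]
      by_cases hp : p x <;> simp [hp, hf]

/-- Cutting at a column turns prefix and suffix conditions on the entries into inequalities between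
counts in two column words, the form needed for sliding. -/
theorem BiSorted.split {L : List (ℕ × ℕ)} (h : BiSorted L) (t : ℕ) :
    L = (L.filter fun a => a.1 ≤ t) ++ L.filter fun a => t < a.1 := by
  induction L with
  | nil => rfl
  | cons a L ih =>
    have h' := List.pairwise_cons.1 h
    by_cases ha : a.1 ≤ t
    · have ih := ih h'.2
      simpa [ha] using ih
    · have h1 : (L.filter fun a => a.1 ≤ t) = [] := by
        rw [List.filter_eq_nil_iff]
        intro b hb
        have := h'.1 b hb
        simp; omega
      have h2 : (L.filter fun a => t < a.1) = L := by
        rw [List.filter_eq_self]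
        intro b hb
        have := h'.1 b hb
        simp; omega
      have hb : t < a.1 := by omega
      simp [ha, hb, h1, h2]

theorem BiSorted.countP_le_of_prefixBallot {L : List (ℕ × ℕ)} (h : BiSorted L) {i : ℕ}
    (hb : PrefixBallot i (L.map Prod.snd)) (t : ℕ) :
    (colWord L i).countP (· ≤ t) ≤ (colWord L (i + 1)).countP (· ≤ t) := by
  rw [countP_colWord, countP_colWord]
  have := congrArg (List.map Prod.snd) (h.split t)
  rw [List.map_append] at this
  exact hb _ _ this

theorem BiSorted.countP_le_of_suffixBallot {L : List (ℕ × ℕ)} (h : BiSorted L) {i : ℕ}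
    (hb : SuffixBallot i (L.map Prod.snd)) (t : ℕ) :
    (colWord L (i + 1)).countP (t ≤ ·) ≤ (colWord L i).countP (t ≤ ·) := by
  rw [countP_colWord, countP_colWord]
  cases t with
  | zero =>
    simpa using hb [] _ rfl
  | succ t =>
    have := congrArg (List.map Prod.snd) (h.split t)
    rw [List.map_append] at this
    exact hb _ _ this

theorem colWords_congr {L L' : List (ℕ × ℕ)} {n : ℕ}
    (h : ∀ e, 1 ≤ e → e ≤ n → colWord L e = colWord L' e) : colWords L n = colWords L' n := by
  induction n with
  | zero => rfl
  | succ n ih =>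
    rw [colWords, colWords, h (n + 1) (by omega) le_rfl, ih fun e h1 h2 => h e h1 (by omega)]

theorem knuth_colWords {L L' : List (ℕ × ℕ)} {i n : ℕ} (hi : 1 ≤ i) (hn : i + 1 ≤ n)
    (h : ∀ e, e ≠ i → e ≠ i + 1 → colWord L e = colWord L' e)
    (hK : Knuth (colWord L (i + 1) ++ colWord L i) (colWord L' (i + 1) ++ colWord L' i)) :
    Knuth (colWords L n).flatten (colWords L' n).flatten := by
  induction n with
  | zero => omega
  | succ n ih =>
    rcases Nat.lt_or_eq_of_le hn with hlt | heq
    · rw [colWords, colWords, List.flatten_cons, List.flatten_cons, h (n + 1) (by omega) (by omega)]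
      exact (ih (by omega)).append_left _
    · obtain rfl : i = n := by omega
      obtain ⟨j, rfl⟩ := Nat.exists_eq_succ_of_ne_zero (show i ≠ 0 by omega)
      simp only [colWords, List.flatten_cons, Nat.succ_eq_add_one] at hK ⊢
      rw [colWords_congr fun e _ _ => h e (by omega) (by omega), ← List.append_assoc,
        ← List.append_assoc]
      exact hK.append_right _

/-- Lowering `i + 1` to `i` can fail only if column `x` has an `i` in `S`. The ballot condition then
puts an `i + 1` before it in `S`, hence in the same column below the first `i + 1` in the reading
order, against strictness. The converse is symmetric, with `P`. -/
theorem biSorted_change {P S : List (ℕ × ℕ)} {x i : ℕ}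
    (hP : SuffixBallot i (P.map Prod.snd)) (hS : PrefixBallot i (S.map Prod.snd)) :
    BiSorted (P ++ (x, i + 1) :: S) ↔ BiSorted (P ++ (x, i) :: S) := by
  simp only [BiSorted, List.pairwise_append, List.pairwise_cons, List.mem_cons, forall_eq_or_imp]
  constructor
  · rintro ⟨h1, ⟨h2, h3⟩, h4⟩
    refine ⟨h1, ⟨fun s hs => ?_, h3⟩, fun p hp => ⟨?_, (h4 p hp).2⟩⟩
    · have hs1 := h2 s hs
      by_contra hne
      have hs2 : s = (x, i) := by
        ext
        · simp at *; omega
        · simp at *; omega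
      subst hs2
      obtain ⟨S₁, S₂, rfl⟩ := List.append_of_mem hs
      have hc := hS ((S₁ ++ [(x, i)]).map Prod.snd) (S₂.map Prod.snd) (by simp)
      have : 0 < (S₁.map Prod.snd).count (i + 1) := by
        simp at hc; omega
      rw [List.count_pos_iff, List.mem_map] at this
      obtain ⟨⟨c, f⟩, hcm, hf⟩ := this
      simp at hf; subst hf
      have g1 := h2 (c, i + 1) (by simp [hcm])
      have g2 := (List.pairwise_append.1 h3).2.2 _ hcm (x, i) (by simp)
      simp at g1 g2; omega
    · have := (h4 p hp).1
      simp at *; omega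
  · rintro ⟨h1, ⟨h2, h3⟩, h4⟩
    refine ⟨h1, ⟨fun s hs => ?_, h3⟩, fun p hp => ⟨?_, (h4 p hp).2⟩⟩
    · have := h2 s hs
      simp at *; omega
    · have hp1 := (h4 p hp).1
      by_contra hne
      have hp2 : p = (x, i + 1) := by
        ext
        · simp at *; omega
        · simp at *; omega
      subst hp2
      obtain ⟨P₁, P₂, rfl⟩ := List.append_of_mem hp
      have hc := hP (P₁.map Prod.snd) (((x, i + 1) :: P₂).map Prod.snd) (by simp)
      have : 0 < (P₂.map Prod.snd).count i := by
        simp at hc; omega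
      rw [List.count_pos_iff, List.mem_map] at this
      obtain ⟨⟨c, f⟩, hcm, hf⟩ := this
      simp at hf; subst hf
      have g1 := (h4 (c, f) (by simp [hcm])).1
      have g2 := (List.pairwise_cons.1 (List.pairwise_append.1 h1).2.1).1 _ hcm
      simp at g1 g2; omega

/-- The change moves `x` from the column word of `i + 1` to that of `i`. Column words are
decreasing, so `S` supplies the letters left of `x` and `P` those right of it; the two ballot
conditions are the two inequalities of `knuth_slide`. -/
theorem knuth_change {P S : List (ℕ × ℕ)} {x i n : ℕ} (hi : 1 ≤ i) (hn : i + 1 ≤ n)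
    (hP : SuffixBallot i (P.map Prod.snd)) (hS : PrefixBallot i (S.map Prod.snd))
    (hL : BiSorted (P ++ (x, i + 1) :: S)) :
    Knuth (colWords (P ++ (x, i + 1) :: S) n).flatten
      (colWords (P ++ (x, i) :: S) n).flatten := by
  have hL' := (biSorted_change hP hS).1 hL
  have hPs : BiSorted P := (List.pairwise_append.1 hL).1
  have hSs : BiSorted S := (List.pairwise_cons.1 (List.pairwise_append.1 hL).2.1).2
  have e1 : colWord (P ++ (x, i + 1) :: S) (i + 1) =
      colWord S (i + 1) ++ x :: colWord P (i + 1) := by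
    simp [colWord_append, colWord_cons_self]
  have e2 : colWord (P ++ (x, i + 1) :: S) i = colWord S i ++ colWord P i := by
    rw [colWord_append, colWord_cons_ne _ (by omega)]
  have e3 : colWord (P ++ (x, i) :: S) (i + 1) = colWord S (i + 1) ++ colWord P (i + 1) := by
    rw [colWord_append, colWord_cons_ne _ (by omega)]
  have e4 : colWord (P ++ (x, i) :: S) i = colWord S i ++ x :: colWord P i := by
    simp [colWord_append, colWord_cons_self]
  refine knuth_colWords hi hn (fun e h1 h2 => ?_) ?_
  · rw [colWord_append, colWord_append, colWord_cons_ne _ h1.symm, colWord_cons_ne _ h2.symm]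
  · have s1 := hL.colWord_sorted (i + 1)
    have s2 := hL'.colWord_sorted i
    rw [e1] at s1
    rw [e4] at s2
    rw [e1, e2, e3, e4]
    exact knuth_slide s1 s2 (hSs.countP_le_of_prefixBallot hS) (hPs.countP_le_of_suffixBallot hP)

theorem eq_of_map_fst_of_map_snd {L L' : List (ℕ × ℕ)} (h1 : L.map Prod.fst = L'.map Prod.fst)
    (h2 : L.map Prod.snd = L'.map Prod.snd) : L = L' := by
  rw [← List.zip_unzip L, ← List.zip_unzip L', List.unzip_eq_map, List.unzip_eq_map, h1, h2]

theorem biword_fill_succ {L L' : List (ℕ × ℕ)} {i k : ℕ} {u : List ℕ} {us : List (List ℕ)}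
    (hu : Balanced i u) (hus : ∀ u ∈ us, Balanced i u) (hk : k < us.length)
    (hfst : L.map Prod.fst = L'.map Prod.fst) (hL : L.map Prod.snd = u ++ fillWord i k us)
    (hL' : L'.map Prod.snd = u ++ fillWord i (k + 1) us) :
    (BiSorted L ↔ BiSorted L') ∧ ∀ n, 1 ≤ i → i + 1 ≤ n → BiSorted L →
      Knuth (colWords L n).flatten (colWords L' n).flatten := by
  obtain ⟨P, S, h1, h2, h3, h4⟩ := fillWord_succ hus hk
  rw [h1, ← List.append_assoc] at hL
  rw [h2, ← List.append_assoc] at hL'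
  have h3' := hu.suffixBallot.append h3
  obtain ⟨LP, LS', rfl, hP, hS'⟩ := List.map_eq_append_iff.1 hL
  obtain ⟨⟨x, e⟩, LS, rfl, he, hS⟩ := List.map_eq_cons_iff.1 hS'
  simp only at he
  subst he
  have hL'eq : L' = LP ++ (x, i) :: LS := by
    refine eq_of_map_fst_of_map_snd ?_ ?_
    · rw [← hfst]; simp
    · rw [hL', ← hP, ← hS]; simp
  subst hL'eq
  rw [← hP] at h3'
  rw [← hS] at h4
  exact ⟨biSorted_change h3' h4, fun n h1 h2 h => knuth_change h1 h2 h3' h4 h⟩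

theorem biword_fill_le {L L' : List (ℕ × ℕ)} {i j k : ℕ} {u : List ℕ} {us : List (List ℕ)}
    (hu : Balanced i u) (hus : ∀ u ∈ us, Balanced i u) (hjk : j ≤ k) (hk : k ≤ us.length)
    (hfst : L.map Prod.fst = L'.map Prod.fst) (hL : L.map Prod.snd = u ++ fillWord i j us)
    (hL' : L'.map Prod.snd = u ++ fillWord i k us) :
    (BiSorted L ↔ BiSorted L') ∧ ∀ n, 1 ≤ i → i + 1 ≤ n → BiSorted L →
      Knuth (colWords L n).flatten (colWords L' n).flatten := by
  induction k, hjk using Nat.le_induction generalizing L' with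
  | base =>
    obtain rfl := eq_of_map_fst_of_map_snd hfst (hL.trans hL'.symm)
    exact ⟨Iff.rfl, fun _ _ _ _ => .refl _⟩
  | succ k hjk ih =>
    have hlen : (L'.map Prod.fst).length = (u ++ fillWord i k us).length := by
      have := congrArg List.length hL'
      simp only [List.length_map, List.length_append] at this ⊢
      rw [this, length_fillWord i (k + 1) k]
    -- The intermediate biword keeps the columns and has one unpaired `i` fewer, so each step
    -- changes a single entry.
    set M := (L'.map Prod.fst).zip (u ++ fillWord i k us) with hM
    have hM1 : M.map Prod.fst = L'.map Prod.fst := List.map_fst_zip hlen.le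
    have hM2 : M.map Prod.snd = u ++ fillWord i k us := List.map_snd_zip hlen.ge
    obtain ⟨h1, h2⟩ := ih (L' := M) (by omega) (hfst.trans hM1.symm) hM2
    obtain ⟨h3, h4⟩ := biword_fill_succ hu hus (by omega) hM1 hM2 hL'
    exact ⟨h1.trans h3, fun n hi hn h => (h2 n hi hn h).trans (h4 n hi hn (h1.1 h))⟩

theorem biword_fill {L L' : List (ℕ × ℕ)} {i j k : ℕ} {u : List ℕ} {us : List (List ℕ)}
    (hu : Balanced i u) (hus : ∀ u ∈ us, Balanced i u) (hj : j ≤ us.length) (hk : k ≤ us.length)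
    (hfst : L.map Prod.fst = L'.map Prod.fst) (hL : L.map Prod.snd = u ++ fillWord i j us)
    (hL' : L'.map Prod.snd = u ++ fillWord i k us) (hs : BiSorted L) :
    BiSorted L' ∧ ∀ n, 1 ≤ i → i + 1 ≤ n →
      Knuth (colWords L n).flatten (colWords L' n).flatten := by
  rcases le_total j k with h | h
  · obtain ⟨h1, h2⟩ := biword_fill_le hu hus h hk hfst hL hL'
    exact ⟨h1.1 hs, fun n hi hn => h2 n hi hn hs⟩
  · obtain ⟨h1, h2⟩ := biword_fill_le hu hus h hj hfst.symm hL' hL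
    exact ⟨h1.2 hs, fun n hi hn => (h2 n hi hn (h1.2 hs)).symm⟩

/-! ### Ballot biwords and extremal insertion shapes. -/

theorem domLE_of_countP {A B : List ℕ} (hA : A.Pairwise (· > ·)) (hB : B.Pairwise (· > ·))
    (h : ∀ t, A.countP (t ≤ ·) ≤ B.countP (t ≤ ·)) : DomLE A B := by
  induction A generalizing B with
  | nil => exact .nil _
  | cons a A ih =>
    have hA' := List.pairwise_cons.1 hA
    have h1 : 0 < B.countP (a ≤ ·) := by
      have := h a
      simp at this
      omega
    obtain ⟨b, hb, hab⟩ := List.countP_pos_iff.1 h1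
    simp only [decide_eq_true_eq] at hab
    cases B with
    | nil => simp at hb
    | cons c B =>
      have hB' := List.pairwise_cons.1 hB
      have hac : a ≤ c := by
        rcases List.mem_cons.1 hb with rfl | hb
        · exact hab
        · have := hB'.1 b hb; omega
      refine .cons hac (ih hA'.2 hB'.2 fun t => ?_)
      have ht := h t
      simp only [List.countP_cons, decide_eq_true_eq] at ht
      by_cases hta : t ≤ a
      · simp only [hta, if_true, show t ≤ c by omega] at ht
        omega
      · have : A.countP (t ≤ ·) = 0 := by
          rw [List.countP_eq_zero]
          intro y hy
          have := hA'.1 y hy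
          simp; omega
        omega

theorem BiSorted.domLE {L : List (ℕ × ℕ)} (h : BiSorted L) {i : ℕ}
    (hb : SuffixBallot i (L.map Prod.snd)) : DomLE (colWord L (i + 1)) (colWord L i) :=
  domLE_of_countP (h.colWord_sorted _) (h.colWord_sorted _) (h.countP_le_of_suffixBallot hb)

theorem mem_colWords {L : List (ℕ × ℕ)} {n : ℕ} {B : List ℕ} :
    B ∈ colWords L n ↔ ∃ e, 1 ≤ e ∧ e ≤ n ∧ B = colWord L e := by
  induction n with
  | zero => simp [colWords]
  | succ n ih =>
    rw [colWords, List.mem_cons, ih]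
    constructor
    · rintro (rfl | ⟨e, h1, h2, rfl⟩)
      · exact ⟨n + 1, by omega, le_rfl, rfl⟩
      · exact ⟨e, h1, by omega, rfl⟩
    · rintro ⟨e, h1, h2, rfl⟩
      rcases Nat.lt_or_eq_of_le h2 with h | rfl
      · exact .inr ⟨e, h1, by omega, rfl⟩
      · exact .inl rfl

theorem isChain_colWords {r : List ℕ → List ℕ → Prop} {L : List (ℕ × ℕ)} {n : ℕ}
    (h : ∀ i, 1 ≤ i → i + 1 ≤ n → r (colWord L (i + 1)) (colWord L i)) :
    (colWords L n).IsChain r := by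
  induction n with
  | zero => simp [colWords]
  | succ n ih =>
    cases n with
    | zero => simp [colWords]
    | succ n =>
      rw [colWords, colWords, List.isChain_cons_cons, ← colWords]
      exact ⟨h (n + 1) (by omega) le_rfl, ih fun i h1 h2 => h i h1 (by omega)⟩

theorem BiSorted.shape_of_ballot {L : List (ℕ × ℕ)} (h : BiSorted L) {n : ℕ}
    (hb : ∀ i, 1 ≤ i → i + 1 ≤ n → SuffixBallot i (L.map Prod.snd)) :
    (insertionTableau (colWords L n).flatten).map List.length =
      conjParts ((colWords L n).map List.length) := by
  apply insertionTableau_cols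
  · intro B hB
    obtain ⟨e, _, _, rfl⟩ := mem_colWords.1 hB
    exact h.colWord_sorted e
  · exact isChain_colWords fun i h1 h2 => h.domLE (hb i h1 h2)

/-- The sum of the squares of the lengths of the column words. -/
def sqSum (L : List (ℕ × ℕ)) (n : ℕ) : ℕ := (((colWords L n).map List.length).map (· ^ 2)).sum

theorem sqSum_eq (L : List (ℕ × ℕ)) (n : ℕ) :
    sqSum L n = ∑ e ∈ Finset.Icc 1 n, ((L.map Prod.snd).count e) ^ 2 := by
  induction n with
  | zero => rfl
  | succ n ih =>
    rw [Finset.sum_Icc_succ_top (by omega), ← ih]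
    simp only [sqSum, colWords, List.map_cons, List.sum_cons, length_colWord]
    omega

theorem sum_change {n i : ℕ} (hi : 1 ≤ i) (hn : i + 1 ≤ n) {f g : ℕ → ℕ}
    (h : ∀ a, a ≠ i → a ≠ i + 1 → f a = g a) :
    ∑ e ∈ Finset.Icc 1 n, f e + (g i + g (i + 1)) =
      ∑ e ∈ Finset.Icc 1 n, g e + (f i + f (i + 1)) := by
  have m1 : i ∈ Finset.Icc 1 n := Finset.mem_Icc.2 ⟨hi, by omega⟩
  have m2 : i + 1 ∈ (Finset.Icc 1 n).erase i :=
    Finset.mem_erase.2 ⟨by omega, Finset.mem_Icc.2 ⟨by omega, hn⟩⟩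
  rw [← Finset.add_sum_erase _ f m1, ← Finset.add_sum_erase _ g m1,
    ← Finset.add_sum_erase _ f m2, ← Finset.add_sum_erase _ g m2]
  have : ∑ e ∈ ((Finset.Icc 1 n).erase i).erase (i + 1), f e =
      ∑ e ∈ ((Finset.Icc 1 n).erase i).erase (i + 1), g e := by
    refine Finset.sum_congr rfl fun a ha => h a ?_ ?_
    · exact (Finset.mem_erase.1 (Finset.mem_erase.1 ha).2).1
    · exact (Finset.mem_erase.1 ha).1
  omega

/-- Turning all unpaired letters into `i` increases the sum of squares. -/
theorem exists_raise {L : List (ℕ × ℕ)} (h : BiSorted L) {n i k : ℕ} (hi : 1 ≤ i)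
    (hn : i + 1 ≤ n) {u : List ℕ} {us : List (List ℕ)}
    (hu : Balanced i u) (hus : ∀ u ∈ us, Balanced i u) (hk : k ≤ us.length)
    (hL : L.map Prod.snd = u ++ fillWord i k us) :
    ∃ L', BiSorted L' ∧ Knuth (colWords L n).flatten (colWords L' n).flatten ∧
      (L'.map Prod.snd).sum + (us.length - k) = (L.map Prod.snd).sum ∧
      sqSum L' n = sqSum L n + 2 * (k * (us.length - k)) := by
  have hlen : (L.map Prod.fst).length = (u ++ fillWord i us.length us).length := by
    have := congrArg List.length hL
    simp only [List.length_map, List.length_append] at this ⊢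
    rw [this, length_fillWord i us.length k]
  set L' := (L.map Prod.fst).zip (u ++ fillWord i us.length us) with hL'
  have h1 : L'.map Prod.fst = L.map Prod.fst := List.map_fst_zip hlen.le
  have h2 : L'.map Prod.snd = u ++ fillWord i us.length us := List.map_snd_zip hlen.ge
  obtain ⟨h3, h4⟩ := biword_fill hu hus hk le_rfl h1.symm hL h2 h
  refine ⟨L', h3, h4 n hi hn, ?_, ?_⟩
  · have e1 := sum_fillWord (i := i) hk
    have e2 := sum_fillWord (i := i) (le_refl us.length)
    rw [hL, h2, List.sum_append, List.sum_append]
    omega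
  · obtain ⟨a1, a2, a3⟩ := count_fillWord (i := i) hk
    obtain ⟨b1, b2, b3⟩ := count_fillWord (i := i) (le_refl us.length)
    have hbal := Balanced.count_flatten hus
    have hbu := hu.count_eq
    rw [sqSum_eq, sqSum_eq]
    have := sum_change hi hn (f := fun e => (L'.map Prod.snd).count e ^ 2)
      (g := fun e => (L.map Prod.snd).count e ^ 2) (fun a ha hb => by
        simp only [hL, h2, List.count_append, a3 a ha hb, b3 a ha hb])
    simp only [hL, h2, List.count_append, a1, a2, b1, b2, hbal, hbu] at this ⊢
    -- With `b` letters of each kind in the balanced parts, the gain is `(b + k + q)² + b² - (b +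
    -- k)² - (b + q)² = 2kq`.
    obtain ⟨q, hq⟩ := Nat.exists_eq_add_of_le hk
    rw [hq] at this ⊢
    simp only [Nat.sub_self, Nat.add_sub_cancel_left] at this ⊢
    nlinarith

/-- Raising at any failing `i` keeps the insertion tableau, lowers the sum of the entries and does
not lower the sum of squares. The process stops at a ballot biword, whose block lengths serve as
`ρ`. -/
theorem exists_shape {L : List (ℕ × ℕ)} (h : BiSorted L) (n : ℕ) :
    ∃ ρ, (insertionTableau (colWords L n).flatten).map List.length = conjParts ρ ∧
      sqSum L n ≤ (ρ.map (· ^ 2)).sum := by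
  induction hs : (L.map Prod.snd).sum using Nat.strong_induction_on generalizing L with
  | _ s ih =>
    by_cases hb : ∀ i, 1 ≤ i → i + 1 ≤ n → SuffixBallot i (L.map Prod.snd)
    · exact ⟨_, h.shape_of_ballot hb, le_rfl⟩
    · push Not at hb
      obtain ⟨i, hi, hn, hb⟩ := hb
      obtain ⟨u, us, k, hu, hus, hk, hL⟩ := exists_blocks i (L.map Prod.snd)
      have hlt : k < us.length := by
        rcases Nat.lt_or_eq_of_le hk with h | rfl
        · exact h
        · exact absurd (hL ▸ hu.suffixBallot.append (suffixBallot_fillWord hus)) hb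
      obtain ⟨L', h1, h2, h3, h4⟩ := exists_raise h hi hn hu hus hk hL
      obtain ⟨ρ, h5, h6⟩ := ih _ (by omega) h1 rfl
      exact ⟨ρ, by rw [h2.insertionTableau_eq, h5], by omega⟩

/-- In a biword whose word has the largest possible insertion shape, unpaired letters `i` and `i + 1`
do not both occur. -/
theorem BiSorted.unpaired_of_shape {L : List (ℕ × ℕ)} (h : BiSorted L) {n i k : ℕ}
    (hshape : (insertionTableau (colWords L n).flatten).map List.length =
      conjParts ((colWords L n).map List.length)) (hi : 1 ≤ i)
    (hn : i + 1 ≤ n) {u : List ℕ} {us : List (List ℕ)}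
    (hu : Balanced i u) (hus : ∀ u ∈ us, Balanced i u) (hk : k ≤ us.length)
    (hL : L.map Prod.snd = u ++ fillWord i k us) : k = 0 ∨ k = us.length := by
  obtain ⟨L', h1, h2, h3, h4⟩ := exists_raise h hi hn hu hus hk hL
  obtain ⟨ρ, h5, h6⟩ := exists_shape h1 n
  rw [← h2.insertionTableau_eq, hshape] at h5
  -- The shape already determines the sum of squares of `L`, so raising cannot have increased it,
  -- and its gain `2 * (k * (us.length - k))` vanishes.
  have h7 := sum_sq_eq_of_conjParts_eq h5
  have h8 : sqSum L n = (ρ.map (· ^ 2)).sum := h7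
  have h9 : k * (us.length - k) = 0 := by omega
  rcases Nat.mul_eq_zero.1 h9 with h | h
  · exact .inl h
  · right; omega


/-- This prevents a descent where two blocks meet. If no `i` is unpaired, any `i` has an `i + 1`
before it; if no `i + 1` is unpaired, any `i + 1` has an `i` after it. Earlier in the biword means a
weakly smaller column. -/
theorem BiSorted.exists_le_of_shape {L : List (ℕ × ℕ)} (h : BiSorted L) {n i : ℕ}
    (hshape : (insertionTableau (colWords L n).flatten).map List.length =
      conjParts ((colWords L n).map List.length)) (hi : 1 ≤ i) (hn : i + 1 ≤ n)
    (hne : colWord L i ≠ []) (hne' : colWord L (i + 1) ≠ []) :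
    ∃ a ∈ colWord L (i + 1), ∃ b ∈ colWord L i, a ≤ b := by
  obtain ⟨u, us, k, hu, hus, hk, hL⟩ := exists_blocks i (L.map Prod.snd)
  rcases h.unpaired_of_shape hshape hi hn hu hus hk hL with rfl | rfl
  · obtain ⟨b, hb⟩ := List.exists_mem_of_ne_nil _ hne
    rw [mem_colWord] at hb
    obtain ⟨L₁, L₂, rfl⟩ := List.append_of_mem hb
    have hp := hL ▸ hu.prefixBallot.append (prefixBallot_fillWord hus)
    have := hp ((L₁ ++ [(b, i)]).map Prod.snd) (L₂.map Prod.snd) (by simp)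
    have hc : 0 < (L₁.map Prod.snd).count (i + 1) := by
      simp at this; omega
    rw [List.count_pos_iff, List.mem_map] at hc
    obtain ⟨⟨a, e⟩, ha, he⟩ := hc
    simp only at he
    subst he
    refine ⟨a, mem_colWord.2 (by simp [ha]), b, mem_colWord.2 (by simp), ?_⟩
    have := (List.pairwise_append.1 h).2.2 _ ha (b, i) (by simp)
    simp at this; omega
  · obtain ⟨a, ha⟩ := List.exists_mem_of_ne_nil _ hne'
    rw [mem_colWord] at ha
    obtain ⟨L₁, L₂, rfl⟩ := List.append_of_mem ha
    have hp := hL ▸ hu.suffixBallot.append (suffixBallot_fillWord hus)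
    have := hp (L₁.map Prod.snd) (((a, i + 1) :: L₂).map Prod.snd) (by simp)
    have hc : 0 < (L₂.map Prod.snd).count i := by
      simp at this; omega
    rw [List.count_pos_iff, List.mem_map] at hc
    obtain ⟨⟨b, e⟩, hb, he⟩ := hc
    simp only at he
    subst he
    refine ⟨a, mem_colWord.2 (by simp), b, mem_colWord.2 (by simp [hb]), ?_⟩
    have := (List.pairwise_cons.1 (List.pairwise_append.1 h).2.1).1 _ hb
    simp at this; omega

theorem getLast_le_of_mem {A : List ℕ} (hA : A.Pairwise (· > ·)) {a : ℕ} (ha : a ∈ A) :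
    A.getLast (List.ne_nil_of_mem ha) ≤ a := by
  induction A using List.reverseRecOn with
  | nil => simp at ha
  | append_singleton A c =>
    rw [List.getLast_append_singleton]
    rcases List.mem_append.1 ha with h | h
    · exact ((List.pairwise_append.1 hA).2.2 a h c (by simp)).le
    · simp at h; omega

theorem le_head_of_mem {A : List ℕ} (hA : A.Pairwise (· > ·)) {a : ℕ} (ha : a ∈ A) :
    a ≤ A.head (List.ne_nil_of_mem ha) := by
  cases A with
  | nil => simp at ha
  | cons c A =>
    rcases List.mem_cons.1 ha with rfl | h
    · simp
    · exact ((List.pairwise_cons.1 hA).1 a h).le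

/-- If the insertion shape is the largest possible one, then the column words of the biword are the
maximal column words. -/
theorem BiSorted.columnFactors_eq {L : List (ℕ × ℕ)} (h : BiSorted L) {n : ℕ}
    (hshape : (insertionTableau (colWords L n).flatten).map List.length =
      conjParts ((colWords L n).map List.length))
    (hne : ∀ e, 1 ≤ e → e ≤ n → colWord L e ≠ []) :
    columnFactors (colWords L n).flatten = colWords L n := by
  apply List.splitBy_flatten
  · intro hmem
    obtain ⟨e, h1, h2, he⟩ := mem_colWords.1 hmem
    exact hne e h1 h2 he.symm
  · intro B hB
    obtain ⟨e, h1, h2, rfl⟩ := mem_colWords.1 hB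
    have := (h.colWord_sorted e).isChain
    simpa using this
  · refine isChain_colWords fun i h1 h2 => ?_
    have hn1 := hne i h1 (by omega)
    have hn2 := hne (i + 1) (by omega) h2
    refine ⟨hn2, hn1, ?_⟩
    obtain ⟨a, ha, b, hb, hab⟩ := h.exists_le_of_shape hshape h1 h2 hn1 hn2
    have g1 := getLast_le_of_mem (h.colWord_sorted _) ha
    have g2 := le_head_of_mem (h.colWord_sorted _) hb
    simp only [decide_eq_false_iff_not, not_lt]
    omega

/-- If the insertion shape is the largest possible one and there are at least as many letters `i` as
letters `i + 1`, then the word is a ballot word for `i`. -/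
theorem BiSorted.suffixBallot_of_shape {L : List (ℕ × ℕ)} (h : BiSorted L) {n i : ℕ}
    (hshape : (insertionTableau (colWords L n).flatten).map List.length =
      conjParts ((colWords L n).map List.length)) (hi : 1 ≤ i) (hn : i + 1 ≤ n)
    (hle : (L.map Prod.snd).count (i + 1) ≤ (L.map Prod.snd).count i) :
    SuffixBallot i (L.map Prod.snd) := by
  obtain ⟨u, us, k, hu, hus, hk, hL⟩ := exists_blocks i (L.map Prod.snd)
  have hk' := h.unpaired_of_shape hshape hi hn hu hus hk hL
  obtain ⟨a1, a2, -⟩ := count_fillWord (i := i) hk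
  rw [hL, List.count_append, List.count_append, a1, a2, hu.count_eq,
    Balanced.count_flatten hus] at hle
  have : k = us.length := by omega
  subst this
  exact hL ▸ hu.suffixBallot.append (suffixBallot_fillWord hus)

theorem biSorted_ext {L L' : List (ℕ × ℕ)} (h : BiSorted L) (h' : BiSorted L')
    (hmem : ∀ a, a ∈ L ↔ a ∈ L') : L = L' := by
  have nd : ∀ {L : List (ℕ × ℕ)}, BiSorted L → L.Nodup := fun h =>
    h.imp fun {a b} hab => by rintro rfl; omega
  refine List.Perm.eq_of_pairwise ?_ h h' ((List.perm_ext_iff_of_nodup (nd h) (nd h')).2 hmem)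
  intro a b _ _ h1 h2
  omega

/-! ### The biword of a tableau -/

theorem mem_skewBoxes {lam mu : YoungDiagram} {r c : ℕ} :
    (r, c) ∈ skewBoxes lam mu ↔ InSkew lam mu r c := by
  simp only [skewBoxes, List.mem_flatMap, List.mem_range, List.mem_map, List.mem_reverse,
    List.mem_range'_1, Prod.mk.injEq, InSkew]
  have h1 : (r, c) ∈ lam ↔ r < lam.colLen c := YoungDiagram.mem_iff_lt_colLen
  have h2 : (r, c) ∈ mu ↔ r < mu.colLen c := YoungDiagram.mem_iff_lt_colLen
  constructor
  · rintro ⟨c', _, r', h, rfl, rfl⟩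
    rw [h1, h2]
    omega
  · rintro ⟨h, h'⟩
    have h3 := h1.1 h
    have h4 := h2.not.1 h'
    refine ⟨c, ?_, r, by omega, rfl, rfl⟩
    have : (0, c) ∈ lam := lam.up_left_mem (Nat.zero_le r) le_rfl h
    exact YoungDiagram.mem_iff_lt_rowLen.1 this

theorem pairwise_skewBoxes (lam mu : YoungDiagram) :
    (skewBoxes lam mu).Pairwise fun a b => a.2 < b.2 ∨ (a.2 = b.2 ∧ b.1 < a.1) := by
  rw [skewBoxes, List.pairwise_flatMap]
  constructor
  · intro c _
    rw [List.pairwise_map, List.pairwise_reverse]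
    exact (List.pairwise_lt_range' _ Nat.one_pos).imp fun h => .inr ⟨rfl, h⟩
  · refine List.pairwise_lt_range.imp fun {c c'} hc a ha b hb => ?_
    simp only [List.mem_map] at ha hb
    obtain ⟨_, _, rfl⟩ := ha
    obtain ⟨_, _, rfl⟩ := hb
    exact .inl hc

/-- The biword of a tableau: the columns (numbered from `1`) and the entries of its boxes. -/
def SkewTableau.biword {lam mu : YoungDiagram} (T : SkewTableau lam mu) : List (ℕ × ℕ) :=
  (skewBoxes lam mu).map fun b => (b.2 + 1, T.entry b.1 b.2)

section
variable {lam mu : YoungDiagram} (T : SkewTableau lam mu)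

theorem SkewTableau.biword_map_snd : T.biword.map Prod.snd = T.crw := by
  simp [SkewTableau.biword, SkewTableau.crw]

theorem SkewTableau.mem_biword {x e : ℕ} :
    (x, e) ∈ T.biword ↔ ∃ r c, InSkew lam mu r c ∧ x = c + 1 ∧ e = T.entry r c := by
  simp only [SkewTableau.biword, List.mem_map, Prod.exists, Prod.mk.injEq, mem_skewBoxes]
  constructor
  · rintro ⟨r, c, h, rfl, rfl⟩
    exact ⟨r, c, h, rfl, rfl⟩
  · rintro ⟨r, c, h, rfl, rfl⟩
    exact ⟨r, c, h, rfl, rfl⟩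

theorem SkewTableau.biSorted_biword : BiSorted T.biword := by
  rw [BiSorted, SkewTableau.biword, List.pairwise_map]
  refine (pairwise_skewBoxes lam mu).imp_of_mem fun {a b} ha hb hab => ?_
  rcases hab with h | ⟨h, h'⟩
  · left; simpa using h
  · right
    obtain ⟨r, c⟩ := a
    obtain ⟨r', c'⟩ := b
    simp only at h h'
    subst h
    exact ⟨rfl, T.col_strict _ _ _ h' (mem_skewBoxes.1 hb) (mem_skewBoxes.1 ha)⟩

theorem SkewTableau.mem_crw {e : ℕ} :
    e ∈ T.crw ↔ ∃ r c, InSkew lam mu r c ∧ e = T.entry r c := by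
  simp only [SkewTableau.crw, List.mem_map, Prod.exists, mem_skewBoxes]
  constructor
  · rintro ⟨r, c, h, rfl⟩
    exact ⟨r, c, h, rfl⟩
  · rintro ⟨r, c, h, rfl⟩
    exact ⟨r, c, h, rfl⟩

end

theorem crw_injective {lam mu : YoungDiagram} {T T' : SkewTableau lam mu} (h : T.crw = T'.crw) :
    T = T' := by
  ext r c
  by_cases hs : InSkew lam mu r c
  · exact List.map_inj_left.1 h (r, c) (mem_skewBoxes.2 hs)
  · rw [T.zeros r c hs, T'.zeros r c hs]

/-- The column words list all pairs (column, entry). A sorted biword is determined by its set of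
pairs, and the shape then places the entries in their boxes. -/
theorem tableau_eq_of_colWords {lam mu : YoungDiagram} {T T' : SkewTableau lam mu} {n : ℕ}
    (hT : ∀ x ∈ T.crw, x ≤ n) (hT' : ∀ x ∈ T'.crw, x ≤ n)
    (h : colWords T.biword n = colWords T'.biword n) : T = T' := by
  have hcol : ∀ e, 1 ≤ e → e ≤ n → colWord T.biword e = colWord T'.biword e := by
    clear hT hT'
    induction n with
    | zero => intro e h1 h2; omega
    | succ n ih =>
      rw [colWords, colWords, List.cons.injEq] at h
      intro e h1 h2
      rcases Nat.lt_or_eq_of_le h2 with h3 | rfl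
      · exact ih h.2 e h1 (by omega)
      · exact h.1
  have hmem : ∀ {T T' : SkewTableau lam mu}, (∀ x ∈ T.crw, x ≤ n) →
      (∀ e, 1 ≤ e → e ≤ n → colWord T.biword e = colWord T'.biword e) →
      ∀ a ∈ T.biword, a ∈ T'.biword := by
    intro T T' hT hcol a ha
    obtain ⟨x, e⟩ := a
    obtain ⟨r, c, hs, rfl, rfl⟩ := T.mem_biword.1 ha
    have h1 := T.pos r c hs
    have h2 := hT _ (T.mem_crw.2 ⟨r, c, hs, rfl⟩)
    rw [← mem_colWord, ← hcol _ h1 h2, mem_colWord]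
    exact ha
  apply crw_injective
  rw [← SkewTableau.biword_map_snd, ← SkewTableau.biword_map_snd,
    biSorted_ext T.biSorted_biword T'.biSorted_biword fun a =>
      ⟨hmem hT hcol a, hmem hT' (fun e h1 h2 => (hcol e h1 h2).symm) a⟩]

/-! ### The word of a tableau is compatible -/

theorem count_colWord {L : List (ℕ × ℕ)} (h : BiSorted L) (x e : ℕ) [Decidable ((x, e) ∈ L)] :
    (colWord L e).count x = if (x, e) ∈ L then 1 else 0 := by
  have hnd : (colWord L e).Nodup := (h.colWord_sorted e).imp fun {a b} hab => by omega
  rw [hnd.count]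
  simp only [mem_colWord]

/-- By strictness, the boxes of a column in `mu` or with entry at most `m` form an initial segment,
and an entry `m + 1`, occurring at most once, sits directly on top of it. -/
theorem SkewTableau.lt_height_iff {lam mu : YoungDiagram} (T : SkewTableau lam mu) (m r c : ℕ) :
    r < (colWords T.biword m).flatten.count (c + 1) + mu.colLen c ↔
      (r, c) ∈ mu ∨ (InSkew lam mu r c ∧ T.entry r c ≤ m) := by
  classical
  have hlam : ∀ r, (r, c) ∈ lam ↔ r < lam.colLen c := fun r => YoungDiagram.mem_iff_lt_colLen
  have hmu : ∀ r, (r, c) ∈ mu ↔ r < mu.colLen c := fun r => YoungDiagram.mem_iff_lt_colLen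
  induction m generalizing r with
  | zero =>
    have : ∀ r, InSkew lam mu r c → T.entry r c ≠ 0 := fun r h => (T.pos r c h).ne'
    simp only [colWords, List.flatten_nil, List.count_nil, zero_add, hmu]
    grind
  | succ m ih =>
    rw [colWords, List.flatten_cons, List.count_append, count_colWord T.biSorted_biword]
    set H := (colWords T.biword m).flatten.count (c + 1) + mu.colLen c with hH
    by_cases hex : (c + 1, m + 1) ∈ T.biword
    · obtain ⟨r₀, c', hs, hc, he⟩ := T.mem_biword.1 hex
      obtain rfl : c' = c := by omega
      have hr₀ : ¬ r₀ < H := by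
        refine (ih r₀).not.2 ?_
        rintro (h | h)
        · exact hs.2 h
        · omega
      have hlt : ∀ r, r < r₀ → r < H := by
        intro r hr
        refine (ih r).2 ?_
        by_cases hm : (r, c') ∈ mu
        · exact .inl hm
        · have hs' : InSkew lam mu r c' := ⟨(hlam r).2 (hr.trans ((hlam r₀).1 hs.1)), hm⟩
          have := T.col_strict _ _ _ hr hs' hs
          exact .inr ⟨hs', by omega⟩
      have hH0 : H = r₀ := by
        rcases Nat.lt_trichotomy H r₀ with h | h | h
        · exact absurd (hlt H h) (lt_irrefl _)
        · exact h
        · exact absurd h hr₀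
      rw [if_pos hex]
      constructor
      · intro hr
        by_cases hr' : r < H
        · rcases (ih r).1 hr' with h | h
          · exact .inl h
          · exact .inr ⟨h.1, by omega⟩
        · obtain rfl : r = r₀ := by omega
          exact .inr ⟨hs, by omega⟩
      · intro hr
        have : r ≤ r₀ := by
          by_contra hgt
          rcases hr with h | h
          · have h1 := (hmu r).1 h
            exact hs.2 ((hmu r₀).2 (by omega))
          · have := T.col_strict _ _ _ (by omega : r₀ < r) hs h.1
            omega
        omega
    · rw [if_neg hex, zero_add]
      refine (ih r).trans ?_
      have : ∀ r, InSkew lam mu r c → T.entry r c ≠ m + 1 := fun r h he =>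
        hex (T.mem_biword.2 ⟨r, c, h, rfl, he.symm⟩)
      grind

theorem SkewTableau.height_antitone {lam mu : YoungDiagram} (T : SkewTableau lam mu) (m : ℕ) :
    Antitone fun c => (colWords T.biword m).flatten.count (c + 1) + mu.colLen c := by
  rw [antitone_iff_succ_le]
  intro c
  refine le_of_forall_lt fun r hr => ?_
  rw [T.lt_height_iff] at hr ⊢
  rcases hr with h | ⟨h, he⟩
  · exact .inl (mu.up_left_mem le_rfl c.le_succ h)
  · by_cases hm : (r, c) ∈ mu
    · exact .inl hm
    · have hs : InSkew lam mu r c := ⟨lam.up_left_mem le_rfl c.le_succ h.1, hm⟩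
      exact .inr ⟨hs, (T.row_weak _ _ _ c.lt_succ_self hs h).trans he⟩

/-- Read from the right, a column word adds boxes in increasing columns. Dropping its first letter
`d` lowers only column `d`; the column after it has not grown yet, so there the inequality for `h`
suffices, and elsewhere the one for the full word does. -/
theorem suffixPartition_of_column {h : ℕ → ℕ} {D : List ℕ} (hD : D.Pairwise (· > ·))
    (h1 : Antitone h) (h2 : Antitone fun c => D.count (c + 1) + h c) : SuffixPartition h D := by
  induction D with
  | nil =>
    intro u hu
    have : u = [] := by simpa using hu
    simpa [this] using h1
  | cons d D ih =>
    have hD' := List.pairwise_cons.1 hD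
    refine suffixPartition_cons.2 ⟨h2, ih hD'.2 ?_⟩
    rw [antitone_iff_succ_le] at h1 h2 ⊢
    intro c
    have e1 := h1 c
    have e2 := h2 c
    simp only [List.count_cons, beq_iff_eq] at e2
    by_cases hd : d = c + 1
    · have : D.count (c + 1 + 1) = 0 := by
        rw [List.count_eq_zero]
        intro hm
        have := hD'.1 _ hm
        omega
      omega
    · simp only [hd, if_false] at e2
      omega

theorem SkewTableau.suffixPartition {lam mu : YoungDiagram} (T : SkewTableau lam mu) (m : ℕ) :
    SuffixPartition mu.colLen (colWords T.biword m).flatten := by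
  induction m with
  | zero =>
    intro u hu
    have : u = [] := by simpa [colWords] using hu
    subst this
    simpa [colWords] using T.height_antitone 0
  | succ m ih =>
    rw [colWords, List.flatten_cons, suffixPartition_append]
    refine ⟨suffixPartition_of_column (T.biSorted_biword.colWord_sorted _) (T.height_antitone m) ?_,
      ih⟩
    have := T.height_antitone (m + 1)
    simpa only [colWords, List.flatten_cons, List.count_append, add_assoc] using this

theorem SkewTableau.isCompatible {lam mu : YoungDiagram} (hmu : mu ≤ lam) (T : SkewTableau lam mu)
    {n : ℕ} (hn : ∀ x ∈ T.crw, x ≤ n) : IsCompatible lam mu (colWords T.biword n).flatten where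
  letters_pos x hx := by
    obtain ⟨B, hB, hxB⟩ := List.mem_flatten.1 hx
    obtain ⟨e, _, _, rfl⟩ := mem_colWords.1 hB
    obtain ⟨r, c, _, rfl, _⟩ := T.mem_biword.1 (mem_colWord.1 hxB)
    omega
  suffix_partition := T.suffixPartition n
  total c := by
    refine eq_of_forall_lt_iff fun r => ?_
    rw [T.lt_height_iff, ← YoungDiagram.mem_iff_lt_colLen]
    constructor
    · rintro (h | h)
      · exact hmu h
      · exact h.1.1
    · intro h
      by_cases hm : (r, c) ∈ mu
      · exact .inl hm
      · exact .inr ⟨⟨h, hm⟩, hn _ (T.mem_crw.2 ⟨r, c, ⟨h, hm⟩, rfl⟩)⟩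

theorem IsCompatible.of_knuth {lam mu : YoungDiagram} {v w : List ℕ} (hv : IsCompatible lam mu v)
    (h : Knuth v w) : IsCompatible lam mu w where
  letters_pos x hx := hv.letters_pos x (h.perm.mem_iff.2 hx)
  suffix_partition := (h.suffixPartition_iff mu.colLen).1 hv.suffix_partition
  total c := by rw [← h.perm.count_eq, hv.total]

/-! ### The column words of `φ(w)` -/

theorem stripHeight_eq_add {lam mu : YoungDiagram} {w : List ℕ} (hw : IsCompatible lam mu w)
    {i : ℕ} (hi : i < (columnFactors w).length) (c : ℕ) :
    stripHeight lam w i c = (columnFactors w)[i].count (c + 1) + stripHeight lam w (i + 1) c := by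
  rw [stripHeight_eq hw, stripHeight_eq hw, List.drop_eq_getElem_cons hi, List.flatten_cons,
    List.count_append, add_assoc]

theorem columnFactors_sorted {w B : List ℕ} (hB : B ∈ columnFactors w) : B.Pairwise (· > ·) := by
  have h : B.IsChain (· > ·) := by
    simpa using List.isChain_of_mem_splitBy hB
  exact List.isChain_iff_pairwise.1 h

/-- The index `i` is that of the factor removing the box, counted from `0`; hence the entry is the
number of factors minus `i`. -/
theorem exists_phiEntry_eq {lam mu : YoungDiagram} {w : List ℕ} (hw : IsCompatible lam mu w)
    {r c : ℕ} (hs : InSkew lam mu r c) :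
    ∃ i < (columnFactors w).length, stripHeight lam w (i + 1) c ≤ r ∧
      r < stripHeight lam w i c ∧ phiEntry lam mu w r c = (columnFactors w).length - i := by
  classical
  have h1 : stripHeight lam w (columnFactors w).length c ≤ r := by
    rw [stripHeight_length hw]
    have := hs.2
    rw [YoungDiagram.mem_iff_lt_colLen] at this
    omega
  have hex : ∃ i, stripHeight lam w i c ≤ r := ⟨_, h1⟩
  have h2 := Nat.find_spec hex
  have h3 := fun m => Nat.find_min hex (m := m)
  have h4 : Nat.find hex ≤ (columnFactors w).length := Nat.find_min' hex h1
  generalize Nat.find hex = k at h2 h3 h4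
  have hr : r < lam.colLen c := YoungDiagram.mem_iff_lt_colLen.1 hs.1
  cases k with
  | zero => simp [stripHeight] at h2; omega
  | succ k =>
    have h5 : r < stripHeight lam w k c := by
      have := h3 k (by omega); omega
    refine ⟨k, by omega, h2, h5, ?_⟩
    rw [phiEntry_eq hs (by omega) h2 (by simpa using h5)]
    omega

theorem phi_mem_biword_iff {lam mu : YoungDiagram} {w : List ℕ} (hw : IsCompatible lam mu w)
    {i : ℕ} (hi : i < (columnFactors w).length) (x : ℕ) :
    (x, (columnFactors w).length - i) ∈ (phi lam mu w hw).biword ↔ x ∈ (columnFactors w)[i] := by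
  rw [SkewTableau.mem_biword]
  constructor
  · rintro ⟨r, c, hs, rfl, he⟩
    obtain ⟨j, hj, h1, h2, h3⟩ := exists_phiEntry_eq hw hs
    have he' : (columnFactors w).length - i = phiEntry lam mu w r c := he
    obtain rfl : j = i := by omega
    rw [stripHeight_eq_add hw hi] at h2
    exact List.count_pos_iff.1 (by omega)
  · intro hx
    have hmem := List.getElem_mem hi
    have hpos : 0 < x := by
      refine hw.letters_pos x ?_
      rw [← List.flatten_splitBy (fun a b => decide (b < a)) w]
      exact List.mem_flatten.2 ⟨_, hmem, hx⟩
    obtain ⟨c, rfl⟩ := Nat.exists_eq_succ_of_ne_zero hpos.ne'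
    have hc : 0 < (columnFactors w)[i].count (c + 1) := List.count_pos_iff.2 hx
    have h1 := stripHeight_eq_add hw hi c
    have h2 : stripHeight lam w i c ≤ lam.colLen c := by simp [stripHeight]
    have h3 : mu.colLen c ≤ stripHeight lam w (i + 1) c := by
      rw [stripHeight_eq hw]; omega
    -- The box of column `c` removed by factor `i` has as row index the height that remains after
    -- the removal.
    have hs : InSkew lam mu (stripHeight lam w (i + 1) c) c := by
      refine ⟨YoungDiagram.mem_iff_lt_colLen.2 (by omega), fun h => ?_⟩
      have := YoungDiagram.mem_iff_lt_colLen.1 h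
      omega
    refine ⟨_, c, hs, rfl, ?_⟩
    have := phiEntry_eq (w := w) hs (i := i + 1) (by omega) le_rfl
      (by rw [Nat.add_sub_cancel]; omega)
    change _ = phiEntry lam mu w _ c
    rw [this]
    omega

theorem phi_colWord {lam mu : YoungDiagram} {w : List ℕ} (hw : IsCompatible lam mu w)
    {i : ℕ} (hi : i < (columnFactors w).length) :
    colWord (phi lam mu w hw).biword ((columnFactors w).length - i) = (columnFactors w)[i] := by
  have s1 := (phi lam mu w hw).biSorted_biword.colWord_sorted ((columnFactors w).length - i)
  have s2 := columnFactors_sorted (List.getElem_mem hi)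
  have nd : ∀ {A : List ℕ}, A.Pairwise (· > ·) → A.Nodup := fun h =>
    h.imp fun {a b} hab => by omega
  refine List.Perm.eq_of_pairwise (fun a b _ _ h1 h2 => by omega) s1 s2
    ((List.perm_ext_iff_of_nodup (nd s1) (nd s2)).2 fun x => ?_)
  rw [mem_colWord, phi_mem_biword_iff]

theorem length_colWords (L : List (ℕ × ℕ)) (n : ℕ) : (colWords L n).length = n := by
  induction n with
  | zero => rfl
  | succ n ih => simp [colWords, ih]

theorem getElem_colWords {L : List (ℕ × ℕ)} {n i : ℕ} (hi : i < (colWords L n).length) :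
    (colWords L n)[i] = colWord L (n - i) := by
  induction n generalizing i with
  | zero => simp [colWords] at hi
  | succ n ih =>
    cases i with
    | zero => simp [colWords]
    | succ i => simp [colWords, ih]

/-- The map from a tableau to its column words undoes `phi`: the factors of `w` come back as the
blocks of the entries, from the largest entry down. -/
theorem phi_colWords {lam mu : YoungDiagram} {w : List ℕ} (hw : IsCompatible lam mu w) :
    colWords (phi lam mu w hw).biword (columnFactors w).length = columnFactors w := by
  refine List.ext_getElem (length_colWords _ _) fun i h1 h2 => ?_
  rw [getElem_colWords, phi_colWord hw h2]

theorem phi_crw_le {lam mu : YoungDiagram} {w : List ℕ} (hw : IsCompatible lam mu w) :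
    ∀ x ∈ (phi lam mu w hw).crw, x ≤ (columnFactors w).length := by
  intro x hx
  obtain ⟨r, c, hs, rfl⟩ := (SkewTableau.mem_crw _).1 hx
  obtain ⟨i, _, _, _, h⟩ := exists_phiEntry_eq hw hs
  change phiEntry lam mu w r c ≤ _
  omega

/-- A tableau is `φ` of its word, if the column words of its entries are maximal. -/
theorem eq_phi {lam mu : YoungDiagram} {T : SkewTableau lam mu} {n : ℕ}
    (hn : ∀ x ∈ T.crw, x ≤ n) {w : List ℕ} (hw : IsCompatible lam mu w)
    (h : columnFactors w = colWords T.biword n) : T = phi lam mu w hw := by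
  have hlen : (columnFactors w).length = n := by rw [h, length_colWords]
  refine tableau_eq_of_colWords hn (hlen ▸ phi_crw_le hw) ?_
  have := phi_colWords hw
  rw [hlen] at this
  rw [this, h]


/-! ### Extremal tableaux and crystal reflections. -/

theorem map_length_colWords (L : List (ℕ × ℕ)) (n : ℕ) :
    (colWords L n).map List.length =
      (List.ofFn fun i : Fin n => (L.map Prod.snd).count ((i : ℕ) + 1)).reverse := by
  induction n with
  | zero => rfl
  | succ n ih =>
    rw [colWords, List.map_cons, ih, List.ofFn_succ_last, List.reverse_append, length_colWord]
    rfl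

theorem count_reflectWord (i : ℕ) (v : List ℕ) :
    (reflectWord i v).count i = v.count (i + 1) ∧ (reflectWord i v).count (i + 1) = v.count i ∧
      ∀ a, a ≠ i → a ≠ i + 1 → (reflectWord i v).count a = v.count a := by
  obtain ⟨u, us, k, hu, hus, hk, rfl⟩ := exists_blocks i v
  rw [reflectWord_blocks hu hus hk]
  obtain ⟨a1, a2, a3⟩ := count_fillWord (i := i) hk
  obtain ⟨b1, b2, b3⟩ := count_fillWord (i := i) (Nat.sub_le us.length k)
  have e1 := hu.count_eq
  have e2 := Balanced.count_flatten hus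
  simp only [List.count_append, a1, a2, b1, b2]
  refine ⟨by omega, by omega, fun a ha hb => by rw [a3 a ha hb, b3 a ha hb]⟩

theorem length_reflectWord (i : ℕ) (v : List ℕ) : (reflectWord i v).length = v.length := by
  obtain ⟨u, us, k, hu, hus, hk, rfl⟩ := exists_blocks i v
  rw [reflectWord_blocks hu hus hk, List.length_append, List.length_append,
    length_fillWord i _ k]

/-- The entries of `T` are at most `n`, its content is `β`, and the word of its columns has the
largest possible insertion shape. -/
structure IsExtremal {lam mu : YoungDiagram} {n : ℕ} (T : SkewTableau lam mu) (β : Fin n → ℕ) :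
    Prop where
  le : ∀ x ∈ T.crw, x ≤ n
  count : ∀ i : Fin n, T.crw.count ((i : ℕ) + 1) = β i
  shape : (insertionTableau (colWords T.biword n).flatten).map List.length =
    conjParts (List.ofFn β)

section
variable {lam mu : YoungDiagram} {n : ℕ} {T : SkewTableau lam mu} {β : Fin n → ℕ}

theorem map_length_colWords_biword (h : ∀ i : Fin n, T.crw.count ((i : ℕ) + 1) = β i) :
    (colWords T.biword n).map List.length = (List.ofFn β).reverse := by
  rw [map_length_colWords, T.biword_map_snd]
  simp only [h]

theorem IsExtremal.shape' (h : IsExtremal T β) :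
    (insertionTableau (colWords T.biword n).flatten).map List.length =
      conjParts ((colWords T.biword n).map List.length) := by
  rw [h.shape, map_length_colWords_biword h.count]
  exact conjParts_eq_of_perm (List.reverse_perm _).symm

theorem colWord_ne_nil {L : List (ℕ × ℕ)} (hpos : ∀ i : Fin n, 0 < (L.map Prod.snd).count ((i : ℕ) + 1))
    (e : ℕ) (h1 : 1 ≤ e) (h2 : e ≤ n) : colWord L e ≠ [] := by
  intro h
  have := hpos ⟨e - 1, by omega⟩
  simp only [Nat.sub_add_cancel h1] at this
  rw [← length_colWord, h] at this
  simp at this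

theorem IsExtremal.columnFactors_eq (h : IsExtremal T β) (hβ : ∀ i, 0 < β i) :
    columnFactors (colWords T.biword n).flatten = colWords T.biword n := by
  refine T.biSorted_biword.columnFactors_eq h.shape' (colWord_ne_nil fun i => ?_)
  rw [T.biword_map_snd, h.count]
  exact hβ i

/-- The rows of the reflected filling are never inspected. Its dual word is Knuth equivalent to that
of `T`, hence compatible. Extremality persists and no block is empty, so the maximal factors are the
blocks, and `phi` of the word is a tableau with the reflected biword. -/
theorem IsExtremal.exists_reflection (h : IsExtremal T β) (hβ : ∀ i, 0 < β i) (hmu : mu ≤ lam)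
    {i : ℕ} (hi : 1 ≤ i) (hn : i + 1 ≤ n) :
    ∃ T' : SkewTableau lam mu, T'.crw = reflectWord i T.crw ∧ (∀ x ∈ T'.crw, x ≤ n) ∧
      Knuth (colWords T.biword n).flatten (colWords T'.biword n).flatten := by
  obtain ⟨c1, c2, c3⟩ := count_reflectWord i T.crw
  have hle : ∀ x ∈ reflectWord i T.crw, x ≤ n ∧ 1 ≤ x := by
    intro x hx
    by_cases h1 : x = i
    · omega
    by_cases h2 : x = i + 1
    · omega
    rw [← List.count_pos_iff, c3 x h1 h2, List.count_pos_iff] at hx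
    refine ⟨h.le x hx, ?_⟩
    obtain ⟨r, c, hs, rfl⟩ := T.mem_crw.1 hx
    exact T.pos r c hs
  have hlen : (T.biword.map Prod.fst).length = (reflectWord i T.crw).length := by
    rw [length_reflectWord, ← T.biword_map_snd, List.length_map, List.length_map]
  set L := (T.biword.map Prod.fst).zip (reflectWord i T.crw)
  have h1 : L.map Prod.fst = T.biword.map Prod.fst := List.map_fst_zip hlen.le
  have h2 : L.map Prod.snd = reflectWord i T.crw := List.map_snd_zip hlen.ge
  obtain ⟨hL, hK⟩ : BiSorted L ∧
      Knuth (colWords T.biword n).flatten (colWords L n).flatten := by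
    obtain ⟨u, us, k, hu, hus, hk, hv⟩ := exists_blocks i T.crw
    obtain ⟨g1, g2⟩ := biword_fill hu hus hk (Nat.sub_le us.length k) h1.symm
      (T.biword_map_snd.trans hv) (by rw [h2, hv, reflectWord_blocks hu hus hk]) T.biSorted_biword
    exact ⟨g1, g2 n hi hn⟩
  have hcount : ∀ e : Fin n, (L.map Prod.snd).count ((e : ℕ) + 1) =
      β (Equiv.swap ⟨i - 1, by omega⟩ ⟨i, by omega⟩ e) := by
    intro e
    rw [h2]
    by_cases e1 : e = ⟨i - 1, by omega⟩
    · subst e1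
      rw [Equiv.swap_apply_left, ← h.count]
      simp only [Nat.sub_add_cancel hi, c1]
    by_cases e2 : e = ⟨i, by omega⟩
    · subst e2
      rw [Equiv.swap_apply_right, ← h.count]
      simp only [Nat.sub_add_cancel hi, c2]
    rw [Equiv.swap_apply_of_ne_of_ne e1 e2, ← h.count]
    rw [Fin.ext_iff] at e1 e2
    simp only at e1 e2
    exact c3 _ (by omega) (by omega)
  have hshape : (insertionTableau (colWords L n).flatten).map List.length =
      conjParts ((colWords L n).map List.length) := by
    rw [← hK.insertionTableau_eq, h.shape, map_length_colWords]
    simp only [hcount]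
    exact conjParts_eq_of_perm
      (((List.reverse_perm _).trans (Equiv.Perm.ofFn_comp_perm _ β)).symm)
  have hfac : columnFactors (colWords L n).flatten = colWords L n :=
    hL.columnFactors_eq hshape (colWord_ne_nil fun e => by rw [hcount]; exact hβ _)
  have hcomp : IsCompatible lam mu (colWords L n).flatten := (T.isCompatible hmu h.le).of_knuth hK
  have hflen : (columnFactors (colWords L n).flatten).length = n := by
    rw [hfac, length_colWords]
  have hphi := phi_colWords hcomp
  have hphile := phi_crw_le hcomp
  rw [hflen] at hphi hphile
  rw [hfac] at hphi
  have hbi : (phi lam mu _ hcomp).biword = L := by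
    set T' := phi lam mu _ hcomp
    have hcol : ∀ e, 1 ≤ e → e ≤ n → colWord T'.biword e = colWord L e := by
      intro e e1 e2
      have hl : n - e < n := by omega
      have := getElem_colWords (L := T'.biword) (n := n) (i := n - e)
        (by rw [length_colWords]; omega)
      have h' := getElem_colWords (L := L) (n := n) (i := n - e) (by rw [length_colWords]; omega)
      rw [Nat.sub_sub_self e2] at this h'
      rw [← this, ← h']
      simp only [hphi]
    refine biSorted_ext T'.biSorted_biword hL fun ⟨x, e⟩ => ?_
    constructor
    · intro hx
      obtain ⟨r, c, hs, _, rfl⟩ := T'.mem_biword.1 hx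
      rw [← mem_colWord, hcol _ (T'.pos r c hs) (hphile _ (T'.mem_crw.2 ⟨r, c, hs, rfl⟩)),
        mem_colWord] at hx
      exact hx
    · intro hx
      have he : e ∈ reflectWord i T.crw := by
        rw [← h2]; exact List.mem_map_of_mem (f := Prod.snd) hx
      rw [← mem_colWord, hcol _ (hle e he).2 (hle e he).1, mem_colWord]
      exact hx
  refine ⟨phi lam mu _ hcomp, ?_, hphile, by rw [hbi]; exact hK⟩
  rw [← SkewTableau.biword_map_snd, hbi, h2]

theorem IsExtremal.crystalReflection_crw (h : IsExtremal T β) (hβ : ∀ i, 0 < β i)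
    (hmu : mu ≤ lam) {i : ℕ} (hi : 1 ≤ i) (hn : i + 1 ≤ n) :
    (crystalReflection i T).crw = reflectWord i T.crw := by
  obtain ⟨T', hT', _⟩ := h.exists_reflection hβ hmu hi hn
  have hex : ∃ T' : SkewTableau lam mu, T'.crw = reflectWord i T.crw := ⟨T', hT'⟩
  rw [crystalReflection, dif_pos hex]
  exact hex.choose_spec

theorem IsExtremal.crystalReflection (h : IsExtremal T β) (hβ : ∀ i, 0 < β i)
    (hmu : mu ≤ lam) (i : Fin (n - 1)) :
    IsExtremal (crystalReflection (i + 1) T) (β ∘ adjSwap i) := by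
  obtain ⟨T', hT', hle, hK⟩ := h.exists_reflection hβ hmu (i := i + 1) (by omega) (by omega)
  have hcrw := h.crystalReflection_crw hβ hmu (i := i + 1) (by omega) (by omega)
  obtain rfl := crw_injective (hT'.trans hcrw.symm)
  refine ⟨hle, fun e => ?_, ?_⟩
  · obtain ⟨c1, c2, c3⟩ := count_reflectWord (i + 1) T.crw
    rw [hT', Function.comp, adjSwap]
    by_cases e1 : e = ⟨i, by omega⟩
    · subst e1
      rw [Equiv.swap_apply_left, ← h.count]
      exact c1
    by_cases e2 : e = ⟨i + 1, by omega⟩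
    · subst e2
      rw [Equiv.swap_apply_right, ← h.count]
      exact c2
    rw [Equiv.swap_apply_of_ne_of_ne e1 e2, ← h.count]
    rw [Fin.ext_iff] at e1 e2
    simp only at e1 e2
    exact c3 _ (by omega) (by omega)
  · rw [← hK.insertionTableau_eq, h.shape]
    exact conjParts_eq_of_perm (Equiv.Perm.ofFn_comp_perm _ β).symm

theorem IsExtremal.crystalReflection_involutive (h : IsExtremal T β) (hβ : ∀ i, 0 < β i)
    (hmu : mu ≤ lam) (i : Fin (n - 1)) :
    FrankWords.crystalReflection (i + 1) (FrankWords.crystalReflection (i + 1) T) = T := by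
  apply crw_injective
  rw [(h.crystalReflection hβ hmu i).crystalReflection_crw (fun e => hβ _) hmu (by omega)
    (by omega), h.crystalReflection_crw hβ hmu (by omega) (by omega), reflectWord_reflectWord]

theorem adjSwap_inv (i : Fin (n - 1)) : (adjSwap i)⁻¹ = adjSwap i := by
  simp [adjSwap]

theorem crystalWord_cons (i : Fin (n - 1)) (word : List (Fin (n - 1))) (T : SkewTableau lam mu) :
    crystalWord (i :: word) T = crystalReflection (i + 1) (crystalWord word T) := rfl

theorem crystalWord_concat (i : Fin (n - 1)) (word : List (Fin (n - 1)))
    (T : SkewTableau lam mu) :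
    crystalWord (word ++ [i]) T = crystalWord word (crystalReflection (i + 1) T) := by
  induction word with
  | nil => rfl
  | cons j word ih => rw [List.cons_append, crystalWord_cons, crystalWord_cons, ih]

/-- The leftmost reflection acts last and precomposes the content with its transposition, in
accordance with `(s τ)⁻¹ = τ⁻¹ s`. -/
theorem IsExtremal.crystalWord (h : IsExtremal T β) (hβ : ∀ i, 0 < β i)
    (hmu : mu ≤ lam) (word : List (Fin (n - 1))) :
    IsExtremal (crystalWord word T) (β ∘ ⇑((word.map adjSwap).prod)⁻¹) := by
  induction word with
  | nil => simpa [FrankWords.crystalWord] using h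
  | cons i word ih =>
    have := ih.crystalReflection (fun e => hβ _) hmu i
    rw [List.map_cons, List.prod_cons, mul_inv_rev, adjSwap_inv]
    exact this

/-- Involutivity cancels the reflections in pairs from the middle. This gives surjectivity without
the braid relations. -/
theorem IsExtremal.crystalWord_reverse (h : IsExtremal T β) (hβ : ∀ i, 0 < β i)
    (hmu : mu ≤ lam) (word : List (Fin (n - 1))) :
    FrankWords.crystalWord word (FrankWords.crystalWord word.reverse T) = T := by
  induction word generalizing T β with
  | nil => rfl
  | cons i word ih =>
    have h1 := ih (h.crystalReflection hβ hmu i) (fun e => hβ _)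
    have h2 := h.crystalReflection_involutive hβ hmu i
    rw [List.reverse_cons, crystalWord_concat, crystalWord_cons, h1, h2]

theorem prod_reverse_adjSwap (word : List (Fin (n - 1))) :
    (word.reverse.map adjSwap).prod = ((word.map adjSwap).prod)⁻¹ := by
  rw [List.prod_inv_reverse, List.map_map, List.map_reverse]
  congr 2

/-! ### Extremal tableaux, frank words and Littlewood–Richardson tableaux. -/

/-- Extremal tableaux are the images under `φ` of frank words. -/
theorem IsExtremal.mem_LRFrankTab (h : IsExtremal T β) (hβ : ∀ i, 0 < β i) (hmu : mu ≤ lam) :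
    T ∈ LRFrankTab lam mu (List.ofFn β).reverse := by
  have hfac := h.columnFactors_eq hβ
  have hform : colForm (colWords T.biword n).flatten = (List.ofFn β).reverse := by
    rw [colForm, hfac, map_length_colWords_biword h.count]
  have hcomp := T.isCompatible hmu h.le
  refine ⟨_, ⟨?_, hform, hcomp⟩, eq_phi h.le hcomp hfac⟩
  rw [IsFrank, rowLens_transpose_sortDiagram, hform, h.shape]
  exact conjParts_eq_of_perm (List.reverse_perm _).symm

/-- The column form fixes the number `n` of factors; these are the blocks of `φ(w)`, so its content
is `β`, and frankness of `w` is the shape condition. -/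
theorem isExtremal_of_mem_LRFrankTab (h : T ∈ LRFrankTab lam mu (List.ofFn β).reverse) :
    IsExtremal T β := by
  obtain ⟨w, ⟨hfrank, hform, hcomp⟩, rfl⟩ := h
  have hlen : (columnFactors w).length = n := by
    simpa [colForm] using congrArg List.length hform
  have hcols := phi_colWords hcomp
  rw [hlen] at hcols
  have hcount : ((fun e : Fin n => (phi lam mu w hcomp).crw.count ((e : ℕ) + 1))) = β := by
    have h1 := map_length_colWords (phi lam mu w hcomp).biword n
    rw [hcols] at h1
    have h2 := h1.symm.trans hform
    rw [SkewTableau.biword_map_snd] at h2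
    exact List.ofFn_injective (List.reverse_injective h2)
  refine ⟨hlen ▸ phi_crw_le hcomp, fun i => congrFun hcount i, ?_⟩
  have hflat : (columnFactors w).flatten = w := List.flatten_splitBy _ w
  rw [hcols, hflat, hfrank, rowLens_transpose_sortDiagram, hform]
  exact conjParts_eq_of_perm (List.reverse_perm _)

theorem rowLen_pos_iff (nu : YoungDiagram) (i : ℕ) : 0 < nu.rowLen i ↔ i < nu.colLen 0 := by
  rw [← YoungDiagram.mem_iff_lt_rowLen, YoungDiagram.mem_iff_lt_colLen]

/-- An extremal tableau has unpaired letters of one kind only, and since the parts of `nu` decrease,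
none of them is an `i + 1`: this is the ballot condition. Conversely, ballot entries make the blocks
a dominating chain, whose insertion shape is known. -/
theorem isExtremal_iff_mem_LRT {nu : YoungDiagram} :
    IsExtremal T (fun i : Fin (nu.colLen 0) => nu.rowLen i) ↔ T ∈ LRT lam mu nu := by
  constructor
  · intro h
    have h0 : ∀ i, nu.colLen 0 < i → T.crw.count i = 0 := by
      intro i hi
      rw [List.count_eq_zero]
      intro hm
      have := h.le i hm
      omega
    have hcont : ∀ i, T.crw.count (i + 1) = nu.rowLen i := by
      intro i
      by_cases hi : i < nu.colLen 0
      · exact h.count ⟨i, hi⟩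
      · rw [h0 _ (by omega)]
        have := (rowLen_pos_iff nu i).not.2 hi
        omega
    refine ⟨hcont, fun u hu i hi => ?_⟩
    obtain ⟨t, ht⟩ := hu
    have hsplit : T.crw = t.reverse ++ u.reverse := by
      rw [← List.reverse_append, ht, List.reverse_reverse]
    by_cases hn : i + 1 ≤ nu.colLen 0
    · have hb : SuffixBallot i (T.biword.map Prod.snd) := by
        refine T.biSorted_biword.suffixBallot_of_shape h.shape' hi hn ?_
        obtain ⟨j, rfl⟩ := Nat.exists_eq_succ_of_ne_zero (show i ≠ 0 by omega)
        rw [T.biword_map_snd, hcont, hcont]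
        exact nu.rowLen_anti _ _ (Nat.le_succ j)
      have := hb t.reverse u.reverse (T.biword_map_snd.trans hsplit)
      simpa only [List.count_reverse] using this
    -- For `i` at least the number of parts, the letter `i + 1` does not occur at all.
    · have h1 := h0 (i + 1) (by omega)
      rw [hsplit, List.count_append, List.count_reverse, List.count_reverse] at h1
      omega
  · rintro ⟨hcont, hlat⟩
    have hb : ∀ i, 1 ≤ i → SuffixBallot i (T.biword.map Prod.snd) := by
      intro i hi u s hs
      rw [T.biword_map_snd] at hs
      have := hlat s.reverse ⟨u.reverse, by rw [hs, List.reverse_append]⟩ i hi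
      simpa only [List.count_reverse] using this
    refine ⟨fun x hx => ?_, fun i => hcont i, ?_⟩
    · obtain ⟨r, c, hs, rfl⟩ := T.mem_crw.1 hx
      have hpos := T.pos r c hs
      obtain ⟨j, hj⟩ := Nat.exists_eq_succ_of_ne_zero hpos.ne'
      have h1 := List.count_pos_iff.2 hx
      rw [hj, Nat.succ_eq_add_one, hcont, rowLen_pos_iff] at h1
      omega
    · rw [T.biSorted_biword.shape_of_ballot fun i h1 _ => hb i h1,
        map_length_colWords_biword (fun i => hcont i)]
      exact conjParts_eq_of_perm (List.reverse_perm _)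

end

/-! ### Reversal of contents and conclusion. -/

theorem reverse_ofFn {n : ℕ} (β : Fin n → ℕ) :
    (List.ofFn β).reverse = List.ofFn fun i => β i.rev := by
  refine List.ext_getElem (by simp) fun i h1 h2 => ?_
  simp only [List.getElem_reverse, List.getElem_ofFn, List.length_ofFn]
  congr 1
  rw [Fin.ext_iff, Fin.val_rev]
  simp only
  omega

/-- The reversal is the action of the longest element `w₀`, and `w₀ · (σ · ν) = (w₀ σ w₀) · (w₀ ·
ν)`. The conjugation arises because blocks are listed from the largest entry down. -/
theorem ofFn_permAct_reversedParts (nu : YoungDiagram) (σ : Equiv.Perm (Fin (nu.colLen 0))) :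
    List.ofFn (permAct (longestPerm (nu.colLen 0) * σ * longestPerm (nu.colLen 0))
      (reversedParts nu)) =
    (List.ofFn ((fun i : Fin (nu.colLen 0) => nu.rowLen i) ∘ ⇑(σ⁻¹))).reverse := by
  rw [reverse_ofFn]
  congr 1
  funext i
  have h : (longestPerm (nu.colLen 0))⁻¹ = longestPerm (nu.colLen 0) := rfl
  simp only [permAct, reversedParts, mul_inv_rev, h, Equiv.Perm.mul_apply, Function.comp]
  simp [longestPerm]

end FrankWords

theorem proposition4p3 (lam mu nu : YoungDiagram) (hmu : mu ≤ lam)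
    (hnu : nu.card + mu.card = lam.card) (σ : Equiv.Perm (Fin (nu.colLen 0)))
    (word : List (Fin (nu.colLen 0 - 1))) (hword : FrankWords.IsReducedWord σ word) :
    FrankWords.reflectedLRT lam mu nu word =
      FrankWords.LRFrankTab lam mu
        (List.ofFn (FrankWords.permAct
          (FrankWords.longestPerm (nu.colLen 0) * σ * FrankWords.longestPerm (nu.colLen 0))
          (FrankWords.reversedParts nu))) := by
  have hpos : ∀ i : Fin (nu.colLen 0), 0 < nu.rowLen i := fun i =>
    (FrankWords.rowLen_pos_iff nu i).2 i.2
  rw [FrankWords.ofFn_permAct_reversedParts]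
  ext T
  constructor
  · rintro ⟨S, hS, rfl⟩
    have h := (FrankWords.isExtremal_iff_mem_LRT.2 hS).crystalWord hpos hmu word
    rw [hword.1] at h
    exact h.mem_LRFrankTab (fun i => hpos _) hmu
  · intro hT
    have h := FrankWords.isExtremal_of_mem_LRFrankTab hT
    -- The reversed word represents `σ⁻¹`, so it brings the content back to `ν`, where extremal
    -- means Littlewood–Richardson.
    refine ⟨FrankWords.crystalWord word.reverse T, FrankWords.isExtremal_iff_mem_LRT.1 ?_,
      h.crystalWord_reverse (fun i => hpos _) hmu word⟩
    have h' := h.crystalWord (fun i => hpos _) hmu word.reverse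
    rw [FrankWords.prod_reverse_adjSwap, hword.1, Function.comp_assoc] at h'
    rw [← Equiv.Perm.coe_mul, inv_inv, inv_mul_cancel, Equiv.Perm.coe_one,
      Function.comp_id] at h'
    exact h'
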